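/- Let $K$ be an algebraically closed field, let $Q$ be a finite (non-empty) connected quiver, and let $\rho$ be a set of paths of length at least $2$ in $Q$ such that the monomial algebra $\Lambda = KQ/\langle\rho\rangle$ is finite dimensional over $K$. (Modules are left modules, and paths are composed like functions.) Then the following conditions are equivalent: 1. $\Lambda$ is self-injective, i.e. the left regular module ${}_\Lambda\Lambda$ is injective; 2. for each simple $\Lambda$-module $S$ with projective cover $P(S)$, the socle $\mathrm{soc}\,P(S)$ is simple, and the map $[S]\mapsto[\mathrm{soc}\,P(S)]$ is a permutation of the set of isomorphism classes of simple $\Lambda$-modules; 3. $\Lambda$ is socle-injective, i.e. each homomorphism $\mathrm{soc}({}_\Lambda\Lambda)\to{}_\Lambda\Lambda$ extends to an endomorphism of ${}_\Lambda\Lambda$; 4. either $\Lambda\cong K$ as $K$-algebras, or there are integers $n\ge 1$ and $l>1$ such that $Q$ is isomorphic to the cyclic quiver $C_n$ (with vertices $\mathbb{Z}/n$ and exactly one arrow $i\to i+1$ for each vertex $i$, so that $C_1$ is a single loop) and $\langle\rho\rangle = R^l$, where $R$ is the arrow ideal of $KQ$, i.e. the two-sided ideal generated by the arrows. -/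

import Mathlib

open Quiver

noncomputable section

namespace MonomialQuiver

universe u v w

/-! ### Path algebras -/

/-- A path of the quiver `V` with arbitrary end points, stored as
`⟨source, target, path⟩`. -/
abbrev AnyPath (V : Type u) [Quiver.{v} V] : Type (max u v) :=
  Σ a b : V, Quiver.Path a b

/-- The length of a path. -/
def AnyPath.len {V : Type u} [Quiver.{v} V] (p : AnyPath V) : ℕ := p.2.2.length

/-- The underlying vector space of the path algebra `KQ`: it has the set of all paths
(including the stationary ones) as a basis. -/
def PathAlgebra (K : Type w) (V : Type u) [Field K] [Quiver.{v} V] : Type (max u v w) :=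
  AnyPath V →₀ K

namespace PathAlgebra

variable (K : Type w) {V : Type u} [Field K] [Quiver.{v} V]

instance : AddCommGroup (PathAlgebra K V) := inferInstanceAs (AddCommGroup (AnyPath V →₀ K))

instance : Module K (PathAlgebra K V) := inferInstanceAs (Module K (AnyPath V →₀ K))

/-- The basis element of the path algebra given by a path. -/
def ofPath (p : AnyPath V) : PathAlgebra K V := Finsupp.single p (1 : K)

/-- The paths form a basis of the path algebra. -/
def pathBasis : Module.Basis (AnyPath V) K (PathAlgebra K V) := ⟨LinearEquiv.refl K _⟩

open Classical in
/-- The product `p q` of two paths, composed like functions (first `q`, then `p`): it is the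
concatenated path if the target of `q` is the source of `p`, and zero otherwise. -/
def pathMul (p q : AnyPath V) : PathAlgebra K V :=
  if h : q.2.1 = p.1 then
    ofPath K ⟨q.1, p.2.1, q.2.2.comp (p.2.2.cast h.symm rfl)⟩
  else 0

/-- The bilinear extension of the product of paths. -/
def mulHom : PathAlgebra K V →ₗ[K] PathAlgebra K V →ₗ[K] PathAlgebra K V :=
  Finsupp.linearCombination K fun p : AnyPath V =>
    (Finsupp.linearCombination K fun q : AnyPath V => pathMul K p q :
      PathAlgebra K V →ₗ[K] PathAlgebra K V)

instance : Mul (PathAlgebra K V) := ⟨fun f g => mulHom K f g⟩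

/-- The unit is the sum of all stationary paths. -/
instance [Fintype V] : One (PathAlgebra K V) :=
  ⟨∑ a : V, ofPath K ⟨a, a, Quiver.Path.nil⟩⟩

theorem mul_def (f g : PathAlgebra K V) : f * g = mulHom K f g := rfl

theorem one_def [Fintype V] :
    (1 : PathAlgebra K V) = ∑ a : V, ofPath K ⟨a, a, Quiver.Path.nil⟩ := rfl

theorem pathBasis_apply (p : AnyPath V) : pathBasis K p = ofPath K p := rfl

theorem ofPath_mul_ofPath (p q : AnyPath V) :
    ofPath K p * ofPath K q = pathMul K p q := by
  rw [mul_def, mulHom, ofPath, ofPath]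
  erw [Finsupp.linearCombination_single, one_smul, Finsupp.linearCombination_single, one_smul]

theorem ofPath_mul_of_eq {a b c : V} (p : Quiver.Path b c) (q : Quiver.Path a b) :
    ofPath K ⟨b, c, p⟩ * ofPath K ⟨a, b, q⟩ = ofPath K ⟨a, c, q.comp p⟩ := by
  rw [ofPath_mul_ofPath, pathMul, dif_pos rfl]; rfl

theorem ofPath_mul_of_ne {a b b' c : V} (p : Quiver.Path b' c) (q : Quiver.Path a b)
    (h : b ≠ b') : ofPath K ⟨b', c, p⟩ * ofPath K ⟨a, b, q⟩ = 0 := by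
  rw [ofPath_mul_ofPath, pathMul, dif_neg h]

theorem ofPath_mul_assoc (p q r : AnyPath V) :
    ofPath K p * ofPath K q * ofPath K r = ofPath K p * (ofPath K q * ofPath K r) := by
  obtain ⟨a, b, p⟩ := p
  obtain ⟨c, d, q⟩ := q
  obtain ⟨e, f, r⟩ := r
  have z1 (x : PathAlgebra K V) : 0 * x = 0 := by rw [mul_def]; simp
  have z2 (x : PathAlgebra K V) : x * 0 = 0 := by rw [mul_def]; simp
  by_cases h1 : d = a
  · subst h1
    rw [ofPath_mul_of_eq]
    by_cases h2 : f = c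
    · subst h2
      rw [ofPath_mul_of_eq, ofPath_mul_of_eq, ofPath_mul_of_eq, Quiver.Path.comp_assoc]
    · rw [ofPath_mul_of_ne K _ _ h2, ofPath_mul_of_ne K _ _ h2, z2]
  · rw [ofPath_mul_of_ne K _ _ h1, z1]
    by_cases h2 : f = c
    · subst h2
      rw [ofPath_mul_of_eq, ofPath_mul_of_ne K _ _ h1]
    · rw [ofPath_mul_of_ne K _ _ h2, z2]

/-- To prove a property of all elements of the path algebra, it suffices to treat linear
combinations built up from paths. -/
theorem induction_paths {P : PathAlgebra K V → Prop} (x : PathAlgebra K V) (zero : P 0)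
    (path : ∀ p, P (ofPath K p)) (add : ∀ x y, P x → P y → P (x + y))
    (smul : ∀ (c : K) x, P x → P (c • x)) : P x := by
  have hx := (pathBasis K (V := V)).mem_span x
  refine Submodule.span_induction (p := fun y _ => P y) ?_ zero
    (fun x y _ _ => add x y) (fun c x _ => smul c x) hx
  rintro _ ⟨p, rfl⟩
  rw [pathBasis_apply]
  exact path p

variable {K}

theorem zero_mul' (x : PathAlgebra K V) : 0 * x = 0 := by simp [mul_def]

theorem mul_zero' (x : PathAlgebra K V) : x * 0 = 0 := by simp [mul_def]

theorem add_mul' (x y z : PathAlgebra K V) : (x + y) * z = x * z + y * z := by simp [mul_def]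

theorem mul_add' (x y z : PathAlgebra K V) : x * (y + z) = x * y + x * z := by simp [mul_def]

theorem smul_mul' (c : K) (x y : PathAlgebra K V) : (c • x) * y = c • (x * y) := by
  simp [mul_def]

theorem mul_smul' (c : K) (x y : PathAlgebra K V) : x * (c • y) = c • (x * y) := by
  simp [mul_def]

theorem mul_assoc' (x y z : PathAlgebra K V) : x * y * z = x * (y * z) := by
  induction x using induction_paths with
  | zero => simp only [zero_mul']
  | add x x' hx hx' => simp only [add_mul', hx, hx']
  | smul c x hx => simp only [smul_mul', hx]
  | path p =>
  induction y using induction_paths with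
  | zero => simp only [zero_mul', mul_zero']
  | add x x' hx hx' => simp only [add_mul', mul_add', hx, hx']
  | smul c x hx => simp only [smul_mul', mul_smul', hx]
  | path q =>
  induction z using induction_paths with
  | zero => simp only [mul_zero']
  | add x x' hx hx' => simp only [mul_add', hx, hx']
  | smul c x hx => simp only [mul_smul', hx]
  | path r => exact ofPath_mul_assoc K p q r

theorem sum_mul' {ι : Type*} (s : Finset ι) (f : ι → PathAlgebra K V) (x : PathAlgebra K V) :
    (∑ i ∈ s, f i) * x = ∑ i ∈ s, f i * x := by
  simp [mul_def]

theorem mul_sum' {ι : Type*} (s : Finset ι) (f : ι → PathAlgebra K V) (x : PathAlgebra K V) :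
    x * (∑ i ∈ s, f i) = ∑ i ∈ s, x * f i := by
  simp [mul_def]

theorem one_mul' [Fintype V] (x : PathAlgebra K V) : 1 * x = x := by
  induction x using induction_paths with
  | zero => exact mul_zero' _
  | add x x' hx hx' => rw [mul_add', hx, hx']
  | smul c x hx => rw [mul_smul', hx]
  | path p =>
    obtain ⟨a, b, p⟩ := p
    rw [one_def, sum_mul', Finset.sum_eq_single b]
    · rw [ofPath_mul_of_eq, Quiver.Path.comp_nil]
    · intro c _ hc
      exact ofPath_mul_of_ne K _ _ (Ne.symm hc)
    · intro h
      exact absurd (Finset.mem_univ b) h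

theorem mul_one' [Fintype V] (x : PathAlgebra K V) : x * 1 = x := by
  induction x using induction_paths with
  | zero => exact zero_mul' _
  | add x x' hx hx' => rw [add_mul', hx, hx']
  | smul c x hx => rw [smul_mul', hx]
  | path p =>
    obtain ⟨a, b, p⟩ := p
    rw [one_def, mul_sum', Finset.sum_eq_single a]
    · rw [ofPath_mul_of_eq, Quiver.Path.nil_comp]
    · intro c _ hc
      exact ofPath_mul_of_ne K _ _ hc
    · intro h
      exact absurd (Finset.mem_univ a) h

instance [Fintype V] : Ring (PathAlgebra K V) where
  __ := (inferInstance : AddCommGroup (PathAlgebra K V))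
  mul := (· * ·)
  one := 1
  left_distrib := mul_add'
  right_distrib := add_mul'
  zero_mul := zero_mul'
  mul_zero := mul_zero'
  mul_assoc := mul_assoc'
  one_mul := one_mul'
  mul_one := mul_one'

instance [Fintype V] : Algebra K (PathAlgebra K V) :=
  Algebra.ofModule smul_mul' mul_smul'

end PathAlgebra

/-! ### Monomial algebras -/

section Ideals

variable (K : Type w) {V : Type u} [Field K] [Quiver.{v} V] [Fintype V]

/-- The two-sided ideal `⟨ρ⟩` of the path algebra generated by a set `ρ` of paths. -/
def relIdeal (ρ : Set (AnyPath V)) : Ideal (PathAlgebra K V) :=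
  (TwoSidedIdeal.span (PathAlgebra.ofPath K '' ρ)).asIdeal

instance (ρ : Set (AnyPath V)) : (relIdeal K ρ).IsTwoSided :=
  inferInstanceAs (TwoSidedIdeal.span (PathAlgebra.ofPath K '' ρ)).asIdeal.IsTwoSided

variable (V) in
/-- The arrow ideal `R` of the path algebra: the two-sided ideal generated by all arrows. -/
def arrowIdeal : Ideal (PathAlgebra K V) :=
  relIdeal K {p : AnyPath V | p.len = 1}

instance : (arrowIdeal K V).IsTwoSided :=
  inferInstanceAs (relIdeal K {p : AnyPath V | p.len = 1}).IsTwoSided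

/-- The monomial algebra `KQ/⟨ρ⟩`. -/
abbrev MonomialAlgebra (ρ : Set (AnyPath V)) : Type (max u v w) :=
  PathAlgebra K V ⧸ relIdeal K ρ

end Ideals

/-- The cyclic quiver with `n ≥ 1` vertices: its vertices are the residue classes modulo `n`, and
there is exactly one arrow `i ⟶ i + 1` for each vertex `i` and no other arrow. For `n = 1` it has
one vertex and one loop. -/
def CyclicQuiver (n : ℕ) : Type := ZMod n

instance (n : ℕ) : Quiver.{0} (CyclicQuiver n) where
  Hom i j := {_x : Unit // (show ZMod n from j) = (show ZMod n from i) + 1}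

/-- An isomorphism of quivers: a bijection on vertices together with bijections on arrows. -/
structure QuiverIso (V : Type*) (W : Type*) [Quiver V] [Quiver W] where
  /-- The bijection on vertices. -/
  vertexEquiv : V ≃ W
  /-- The bijection on arrows. -/
  arrowEquiv : ∀ a b : V, (a ⟶ b) ≃ (vertexEquiv a ⟶ vertexEquiv b)

/-! ### Socles, projective covers and injectivity conditions -/

section Modules

variable (R : Type u) [Ring R]

/-- The socle of a module: the sum of all its simple submodules. -/
def socle (M : Type v) [AddCommGroup M] [Module R M] : Submodule R M :=
  sSup {N : Submodule R M | IsSimpleModule R N}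

/-- `R` is left self-injective: the left regular module is injective. -/
def IsSelfInjective : Prop := Module.Injective R R

/-- `R` is socle-injective: each homomorphism from the socle of the left regular module to the
left regular module extends to an endomorphism of the left regular module. -/
def IsSocleInjective : Prop :=
  ∀ f : socle R R →ₗ[R] R, ∃ g : R →ₗ[R] R, ∀ x : socle R R, g (x : R) = f x

/-- The homomorphism `π : P → S` is a projective cover: `P` is projective, and `π` is surjective
with superfluous kernel. -/
structure IsProjectiveCover {R : Type u} [Ring R] {P S : Type v} [AddCommGroup P] [Module R P]
    [AddCommGroup S] [Module R S] (π : P →ₗ[R] S) : Prop where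
  projective : Module.Projective R P
  surjective : Function.Surjective π
  superfluous : ∀ N : Submodule R P, LinearMap.ker π ⊔ N = ⊤ → N = ⊤

/-- A simple left `R`-module (with carrier in the universe of `R`, which is enough to represent
every simple module up to isomorphism). -/
structure SimpleMod where
  /-- The carrier of the module. -/
  carrier : Type u
  [addCommGroup : AddCommGroup carrier]
  [module : Module R carrier]
  isSimple : IsSimpleModule R carrier

attribute [instance] SimpleMod.addCommGroup SimpleMod.module SimpleMod.isSimple

/-- Two simple modules are identified if they are isomorphic. -/
instance SimpleMod.setoid : Setoid (SimpleMod R) where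
  r S T := Nonempty (S.carrier ≃ₗ[R] T.carrier)
  iseqv := ⟨fun _ => ⟨LinearEquiv.refl R _⟩, fun ⟨e⟩ => ⟨e.symm⟩, fun ⟨e⟩ ⟨f⟩ => ⟨e.trans f⟩⟩

/-- The isomorphism classes of simple left `R`-modules. -/
def SimpleClass : Type (u + 1) := Quotient (SimpleMod.setoid R)

variable {R} in
/-- The isomorphism class `[S]` of a simple module `S`. -/
def SimpleMod.isoClass (S : SimpleMod R) : SimpleClass R := Quotient.mk (SimpleMod.setoid R) S

/-- `R` has a Nakayama permutation: every simple module `S` has a projective cover `P(S)`, the socle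
of `P(S)` is simple, and `[S] ↦ [soc P(S)]` is a permutation of the set of isomorphism classes of
simple modules. (Projective covers are unique up to isomorphism, so the condition is imposed on
all of them.) -/
def HasNakayamaPermutation : Prop :=
  ∃ σ : Equiv.Perm (SimpleClass R), ∀ S : SimpleMod R,
    (∃ (P : Type u) (_ : AddCommGroup P) (_ : Module R P) (π : P →ₗ[R] S.carrier),
      IsProjectiveCover π) ∧
    ∀ (P : Type u) [AddCommGroup P] [Module R P] (π : P →ₗ[R] S.carrier),
      IsProjectiveCover π →
        ∃ h : IsSimpleModule R (socle R P), σ S.isoClass = (SimpleMod.mk (socle R P) h).isoClass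

end Modules

end MonomialQuiver

end

/-! Everything is read off from the basis of `Λ` formed by the good paths, those without a subpath
in `ρ`. Left multiplication prolongs a path at its target, so the maximal good paths from `a` to `b`
give copies of the simple module at `b` in the socle of the projective `Λ e_a`. The hub of the proof
is `TargetDeterminesMaximalPath`; the implications run in the circle 1 → 3 → 2 → 4 → 1, and both 3
and 2 are exploited only through this combinatorial property.

If `p` and `q` are maximal with the same target, socle-injectivity extends the map sending `p` to
`q` to a right multiplication, so `q` ends in `p`; by symmetry they agree. A Nakayama permutation
gives the same conclusion: its injectivity identifies the sources, and simplicity of the socle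
identifies the paths. Conversely, the property and finiteness of `V` give each vertex `a` exactly
one maximal path `P a`, with targets `T a` forming a permutation, and `P a` spans the socle of `Λ
e_a`.

For the shape of the quiver, a sink must be isolated, hence the only vertex. Without sinks, every
good path is an initial segment of some `P a`, so each vertex has one outgoing arrow, to `s a`.
Injectivity of `T` forces the length of `P a` not to decrease along `s`, and makes `s` a
permutation; summing over `V` makes the length constant. Connectedness turns `s` into a single
cycle. Conversely, on a cycle with relations `R ^ l` the sum of the coefficients at paths of length
`l - 1` is a non-degenerate form, which yields self-injectivity. -/

noncomputable section

namespace MonomialQuiver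

universe u v w

/-! ### Ideals of the path algebra spanned by paths -/

section PathIdeals

variable {V : Type u} [Quiver.{v} V]

/-- A path is bad with respect to `ρ` if it has a subpath in `ρ`. -/
def Bad (ρ : Set (AnyPath V)) {a b : V} (p : Quiver.Path a b) : Prop :=
  ∃ (c d : V) (s : Quiver.Path a c) (q : Quiver.Path c d) (t : Quiver.Path d b),
    (⟨c, d, q⟩ : AnyPath V) ∈ ρ ∧ p = (s.comp q).comp t

theorem Bad.comp_right {ρ : Set (AnyPath V)} {a b c : V} {p : Quiver.Path a b} (h : Bad ρ p)
    (q : Quiver.Path b c) : Bad ρ (p.comp q) := by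
  obtain ⟨d, e, s, r, t, hr, rfl⟩ := h
  exact ⟨d, e, s, r, t.comp q, hr, by simp⟩

theorem Bad.comp_left {ρ : Set (AnyPath V)} {a b c : V} {p : Quiver.Path b c} (h : Bad ρ p)
    (q : Quiver.Path a b) : Bad ρ (q.comp p) := by
  obtain ⟨d, e, s, r, t, hr, rfl⟩ := h
  exact ⟨d, e, q.comp s, r, t, hr, by simp⟩

theorem bad_of_mem {ρ : Set (AnyPath V)} {p : AnyPath V} (h : p ∈ ρ) : Bad ρ p.2.2 :=
  ⟨p.1, p.2.1, .nil, p.2.2, .nil, h, by simp⟩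

theorem Bad.le_length {ρ : Set (AnyPath V)} {n : ℕ} (hρ : ∀ p ∈ ρ, n ≤ p.len) {a b : V}
    {p : Quiver.Path a b} (h : Bad ρ p) : n ≤ p.length := by
  obtain ⟨d, e, s, r, t, hr, rfl⟩ := h
  have : n ≤ r.length := hρ _ hr
  simp only [Quiver.Path.length_comp]
  omega

theorem not_bad_of_length_lt {ρ : Set (AnyPath V)} {n : ℕ} (hρ : ∀ p ∈ ρ, n ≤ p.len) {a b : V} {p : Quiver.Path a b}
    (h : p.length < n) : ¬ Bad ρ p := fun h' => absurd (h'.le_length hρ) (not_le.2 h)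

theorem bad_arrows_iff {a b : V} (p : Quiver.Path a b) :
    Bad {p : AnyPath V | p.len = 1} p ↔ 1 ≤ p.length := by
  refine ⟨fun h => h.le_length fun p hp => le_of_eq (Eq.symm hp), fun h => ?_⟩
  obtain ⟨c, q, α, rfl⟩ := (Quiver.Path.length_ne_zero_iff_eq_cons p).1 (by omega)
  exact ⟨c, b, q, α.toPath, .nil, rfl, rfl⟩

variable (K : Type w) [Field K]

/-- The subspace of the path algebra spanned by a set of paths. -/
def pathSpan (X : Set (AnyPath V)) : Submodule K (PathAlgebra K V) :=
  Submodule.span K (PathAlgebra.ofPath K '' X)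

variable {K}

theorem ofPath_mem_pathSpan {X : Set (AnyPath V)} {p : AnyPath V} (hp : p ∈ X) :
    PathAlgebra.ofPath K p ∈ pathSpan K X :=
  Submodule.subset_span ⟨p, hp, rfl⟩

theorem mul_mem_pathSpan {X Y Z : Set (AnyPath V)}
    (h : ∀ (a b c : V) (p : Quiver.Path b c) (q : Quiver.Path a b), (⟨b, c, p⟩ : AnyPath V) ∈ X →
      (⟨a, b, q⟩ : AnyPath V) ∈ Y → (⟨a, c, q.comp p⟩ : AnyPath V) ∈ Z)
    {x y : PathAlgebra K V} (hx : x ∈ pathSpan K X) (hy : y ∈ pathSpan K Y) :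
    x * y ∈ pathSpan K Z := by
  induction hx using Submodule.span_induction with
  | zero => rw [PathAlgebra.zero_mul']; exact zero_mem _
  | add x x' _ _ hx hx' => rw [PathAlgebra.add_mul']; exact add_mem hx hx'
  | smul c x _ hx => rw [PathAlgebra.smul_mul']; exact Submodule.smul_mem _ _ hx
  | mem x hx =>
  induction hy using Submodule.span_induction with
  | zero => rw [PathAlgebra.mul_zero']; exact zero_mem _
  | add x x' _ _ hx hx' => rw [PathAlgebra.mul_add']; exact add_mem hx hx'
  | smul c x _ hx => rw [PathAlgebra.mul_smul']; exact Submodule.smul_mem _ _ hx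
  | mem y hy =>
  obtain ⟨⟨b', c, p⟩, hp, rfl⟩ := hx
  obtain ⟨⟨a, b, q⟩, hq, rfl⟩ := hy
  by_cases hb : b = b'
  · subst hb
    rw [PathAlgebra.ofPath_mul_of_eq]
    exact ofPath_mem_pathSpan (h _ _ _ _ _ hp hq)
  · rw [PathAlgebra.ofPath_mul_of_ne K _ _ hb]
    exact zero_mem _

theorem mem_pathSpan_univ (x : PathAlgebra K V) : x ∈ pathSpan K (Set.univ : Set (AnyPath V)) := by
  induction x using PathAlgebra.induction_paths with
  | zero => exact zero_mem _
  | path p => exact ofPath_mem_pathSpan (Set.mem_univ _)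
  | add x y hx hy => exact add_mem hx hy
  | smul c x hx => exact Submodule.smul_mem _ _ hx

theorem mem_pathSpan_iff {X : Set (AnyPath V)} {x : PathAlgebra K V} :
    x ∈ pathSpan K X ↔ ∀ p ∉ X, (PathAlgebra.pathBasis K).coord p x = 0 := by
  have : pathSpan K X = Submodule.span K (PathAlgebra.pathBasis K '' X) := rfl
  rw [this, Module.Basis.mem_span_image]
  constructor
  · intro h p hp
    by_contra h0
    exact hp (h (Finsupp.mem_support_iff.2 h0))
  · intro h p hp
    by_contra h0
    exact Finsupp.mem_support_iff.1 hp (h p h0)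

variable [Fintype V]

/-- Prolonging a bad path on either side keeps it bad, so the bad paths span a two-sided ideal;
conversely a bad path factors through an element of `ρ`. -/
theorem mem_relIdeal_iff_mem_pathSpan {ρ : Set (AnyPath V)} {x : PathAlgebra K V} :
    x ∈ relIdeal K ρ ↔ x ∈ pathSpan K {p : AnyPath V | Bad ρ p.2.2} := by
  constructor
  · intro h
    have h' : x ∈ TwoSidedIdeal.span (PathAlgebra.ofPath K '' ρ) := h
    induction h' using TwoSidedIdeal.span_induction with
    | mem x hx =>
      obtain ⟨p, hp, rfl⟩ := hx
      exact ofPath_mem_pathSpan (bad_of_mem hp)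
    | zero => exact zero_mem _
    | add x y hx hy hx' hy' => exact add_mem (hx' hx) (hy' hy)
    | neg x hx hx' => exact neg_mem (hx' hx)
    | left_absorb a x hx hx' =>
      exact mul_mem_pathSpan (fun _ _ _ _ q _ hq => Bad.comp_right hq _) (mem_pathSpan_univ a)
        (hx' hx)
    | right_absorb b x hx hx' =>
      exact mul_mem_pathSpan (fun _ _ _ _ q hq _ => Bad.comp_left hq _) (hx' hx)
        (mem_pathSpan_univ b)
  · intro h
    change x ∈ TwoSidedIdeal.span (PathAlgebra.ofPath K '' ρ)
    induction h using Submodule.span_induction with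
    | zero => exact zero_mem _
    | add x x' _ _ hx hx' => exact add_mem hx hx'
    | smul c x _ hx =>
      rw [← one_mul x, ← smul_mul_assoc]
      exact TwoSidedIdeal.mul_mem_left _ _ _ hx
    | mem x hx =>
      obtain ⟨⟨a, b, p⟩, ⟨c, d, s, q, t, hq, hp⟩, rfl⟩ := hx
      have : PathAlgebra.ofPath K ⟨a, b, p⟩ = PathAlgebra.ofPath K ⟨d, b, t⟩ *
          (PathAlgebra.ofPath K ⟨c, d, q⟩ * PathAlgebra.ofPath K ⟨a, c, s⟩) := by
        rw [PathAlgebra.ofPath_mul_of_eq, PathAlgebra.ofPath_mul_of_eq]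
        exact congrArg (fun p => PathAlgebra.ofPath K ⟨a, b, p⟩) hp
      rw [this]
      exact TwoSidedIdeal.mul_mem_left _ _ _ (TwoSidedIdeal.mul_mem_right _ _ _
        (TwoSidedIdeal.subset_span ⟨_, hq, rfl⟩))

theorem mem_relIdeal_iff {ρ : Set (AnyPath V)} {x : PathAlgebra K V} :
    x ∈ relIdeal K ρ ↔ ∀ p : AnyPath V, ¬ Bad ρ p.2.2 → (PathAlgebra.pathBasis K).coord p x = 0 :=
  mem_relIdeal_iff_mem_pathSpan.trans mem_pathSpan_iff

theorem mem_arrowIdeal_pow_iff {k : ℕ} {x : PathAlgebra K V} :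
    x ∈ arrowIdeal K V ^ k ↔ x ∈ pathSpan K {p : AnyPath V | k ≤ p.len} := by
  have h1 (x : PathAlgebra K V) :
      x ∈ arrowIdeal K V ↔ x ∈ pathSpan K {p : AnyPath V | 1 ≤ p.len} := by
    rw [arrowIdeal, mem_relIdeal_iff_mem_pathSpan]
    simp only [bad_arrows_iff]
    rfl
  induction k generalizing x with
  | zero => simpa [Submodule.pow_zero, Ideal.one_eq_top] using mem_pathSpan_univ x
  | succ k ih =>
    rw [Ideal.IsTwoSided.pow_succ]
    constructor
    · intro h
      refine Submodule.mul_induction_on h (fun y hy z hz => ?_) fun y z hy hz => add_mem hy hz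
      refine mul_mem_pathSpan (fun a b c p q hp hq => ?_) ((h1 y).1 hy) (ih.1 hz)
      simp only [AnyPath.len, Set.mem_ofPred_eq, Quiver.Path.length_comp] at *
      omega
    · intro h
      induction h using Submodule.span_induction with
      | zero => exact zero_mem _
      | add x x' _ _ hx hx' => exact add_mem hx hx'
      | smul c x _ hx =>
        rw [← one_mul x, ← smul_mul_assoc]
        exact Ideal.mul_mem_left _ _ hx
      | mem x hx =>
        obtain ⟨⟨a, b, p⟩, hp, rfl⟩ := hx
        have hp' : k + 1 ≤ p.length := hp
        obtain ⟨c, q, α, rfl⟩ := (Quiver.Path.length_ne_zero_iff_eq_cons p).1 (by omega)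
        have : PathAlgebra.ofPath K ⟨a, b, q.cons α⟩ =
            PathAlgebra.ofPath K ⟨c, b, α.toPath⟩ * PathAlgebra.ofPath K ⟨a, c, q⟩ := by
          rw [PathAlgebra.ofPath_mul_of_eq, Quiver.Path.comp_toPath_eq_cons]
        rw [this]
        refine Submodule.mul_mem_mul ((h1 _).2 (ofPath_mem_pathSpan ?_))
          (ih.2 (ofPath_mem_pathSpan ?_))
        · exact le_refl (1 : ℕ)
        · simpa [AnyPath.len] using hp'

/-- Both ideals are spanned by paths, and paths are linearly independent, so comparing the ideals
means comparing the sets of paths. -/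
theorem relIdeal_eq_arrowIdeal_pow_iff {ρ : Set (AnyPath V)} {l : ℕ} :
    relIdeal K ρ = arrowIdeal K V ^ l ↔
      ∀ (a b : V) (p : Quiver.Path a b), Bad ρ p ↔ l ≤ p.length := by
  classical
  constructor
  · intro h a b p
    have h2 := SetLike.ext_iff.1 h (PathAlgebra.ofPath K ⟨a, b, p⟩)
    rw [mem_relIdeal_iff_mem_pathSpan, mem_arrowIdeal_pow_iff] at h2
    have key (X : Set (AnyPath V)) : PathAlgebra.ofPath K ⟨a, b, p⟩ ∈ pathSpan K X ↔
        (⟨a, b, p⟩ : AnyPath V) ∈ X := by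
      refine ⟨fun h => ?_, ofPath_mem_pathSpan⟩
      by_contra hp
      have := mem_pathSpan_iff.1 h _ hp
      rw [← PathAlgebra.pathBasis_apply] at this
      simp at this
    rw [key, key] at h2
    exact h2
  · intro h
    ext x
    rw [mem_relIdeal_iff_mem_pathSpan, mem_arrowIdeal_pow_iff]
    simp only [h]
    rfl

end PathIdeals

/-! ### Paths in a monomial algebra -/

section MonomialAlgebra

variable (K : Type w) {V : Type u} [Field K] [Quiver.{v} V] [Fintype V] (ρ : Set (AnyPath V))

/-- The residue class of a path in the monomial algebra. -/
def cls {a b : V} (p : Quiver.Path a b) : MonomialAlgebra K ρ :=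
  Ideal.Quotient.mk (relIdeal K ρ) (PathAlgebra.ofPath K ⟨a, b, p⟩)

variable {K ρ}

theorem cls_mul_cls {a b c : V} (p : Quiver.Path b c) (q : Quiver.Path a b) :
    cls K ρ p * cls K ρ q = cls K ρ (q.comp p) := by
  rw [cls, cls, ← map_mul, PathAlgebra.ofPath_mul_of_eq]; rfl

theorem cls_mul_cls_of_ne {a b b' c : V} (p : Quiver.Path b' c) (q : Quiver.Path a b)
    (h : b ≠ b') : cls K ρ p * cls K ρ q = 0 := by
  rw [cls, cls, ← map_mul, PathAlgebra.ofPath_mul_of_ne K _ _ h, map_zero]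

theorem cls_eq_zero {a b : V} {p : Quiver.Path a b} (h : Bad ρ p) : cls K ρ p = 0 :=
  Ideal.Quotient.eq_zero_iff_mem.2 (mem_relIdeal_iff_mem_pathSpan.2
    (ofPath_mem_pathSpan (p := ⟨a, b, p⟩) h))

theorem one_eq_sum_cls_nil :
    (1 : MonomialAlgebra K ρ) = ∑ a : V, cls K ρ (Quiver.Path.nil : Quiver.Path a a) := by
  rw [← map_one (Ideal.Quotient.mk (relIdeal K ρ)), PathAlgebra.one_def, map_sum]; rfl

/-- To prove a property of all elements of the monomial algebra, it suffices to treat linear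
combinations built up from good paths. -/
@[elab_as_elim]
theorem cls_induction {P : MonomialAlgebra K ρ → Prop} (x : MonomialAlgebra K ρ) (zero : P 0)
    (path : ∀ (a b : V) (p : Quiver.Path a b), ¬ Bad ρ p → P (cls K ρ p))
    (add : ∀ x y, P x → P y → P (x + y))
    (smul : ∀ (c : K) x, P x → P (c • x)) : P x := by
  obtain ⟨x, rfl⟩ := Ideal.Quotient.mk_surjective x
  induction x using PathAlgebra.induction_paths with
  | zero => simpa using zero
  | path p =>
    by_cases h : Bad ρ p.2.2
    · have := cls_eq_zero (K := K) h
      rw [cls] at this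
      rwa [this]
    · exact path _ _ p.2.2 h
  | add x y hx hy => rw [map_add]; exact add _ _ hx hy
  | smul c x hx =>
    exact smul c _ hx

/-- The linear map on the monomial algebra with prescribed values on paths. -/
def liftPaths {M : Type*} [AddCommGroup M] [Module K M] (φ : AnyPath V → M)
    (h : ∀ p : AnyPath V, Bad ρ p.2.2 → φ p = 0) : MonomialAlgebra K ρ →ₗ[K] M :=
  (Submodule.liftQ ((relIdeal K ρ).restrictScalars K) ((PathAlgebra.pathBasis K).constr K φ) (by
    intro x hx
    replace hx : x ∈ relIdeal K ρ := hx
    rw [mem_relIdeal_iff_mem_pathSpan] at hx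
    rw [LinearMap.mem_ker]
    induction hx using Submodule.span_induction with
    | zero => exact map_zero _
    | add x y _ _ hx hy => rw [map_add, hx, hy, add_zero]
    | smul c x _ hx => rw [map_smul, hx, smul_zero]
    | mem x hx =>
      obtain ⟨p, hp, rfl⟩ := hx
      rw [← PathAlgebra.pathBasis_apply, Module.Basis.constr_basis]
      exact h p hp)) ∘ₗ (Submodule.Quotient.restrictScalarsEquiv K (relIdeal K ρ)).symm.toLinearMap

theorem liftPaths_cls {M : Type*} [AddCommGroup M] [Module K M] (φ : AnyPath V → M)
    (h : ∀ p : AnyPath V, Bad ρ p.2.2 → φ p = 0) {a b : V} (p : Quiver.Path a b) :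
    liftPaths φ h (cls K ρ p) = φ ⟨a, b, p⟩ :=
  (PathAlgebra.pathBasis K).constr_basis K φ ⟨a, b, p⟩

variable (K ρ) in
open Classical in
/-- The coefficient of a good path; it is zero for a bad path. -/
def coeff {a b : V} (p : Quiver.Path a b) : MonomialAlgebra K ρ →ₗ[K] K :=
  liftPaths (fun q => if q = ⟨a, b, p⟩ ∧ ¬ Bad ρ p then 1 else 0) (by
    rintro q hq
    rw [if_neg]
    rintro ⟨rfl, h⟩
    exact h hq)

theorem coeff_cls_self {a b : V} {p : Quiver.Path a b} (h : ¬ Bad ρ p) :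
    coeff K ρ p (cls K ρ p) = 1 := by
  rw [coeff, liftPaths_cls, if_pos ⟨rfl, h⟩]

theorem coeff_cls_of_ne {a b c d : V} {p : Quiver.Path a b} {q : Quiver.Path c d}
    (h : (⟨c, d, q⟩ : AnyPath V) ≠ ⟨a, b, p⟩) : coeff K ρ p (cls K ρ q) = 0 := by
  rw [coeff, liftPaths_cls, if_neg fun h' => h h'.1]

theorem cls_ne_zero {a b : V} {p : Quiver.Path a b} (h : ¬ Bad ρ p) : cls K ρ p ≠ 0 := by
  intro h0
  have := coeff_cls_self (K := K) h
  rw [h0, map_zero] at this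
  exact zero_ne_one this

theorem eq_zero_of_coeff {x : MonomialAlgebra K ρ}
    (h : ∀ (a b : V) (p : Quiver.Path a b), ¬ Bad ρ p → coeff K ρ p x = 0) : x = 0 := by
  classical
  obtain ⟨x, rfl⟩ := Ideal.Quotient.mk_surjective x
  refine Ideal.Quotient.eq_zero_iff_mem.2 (mem_relIdeal_iff.2 fun p hp => ?_)
  rw [← h _ _ p.2.2 hp]
  have : (PathAlgebra.pathBasis K).coord p = coeff K ρ p.2.2 ∘ₗ
      (Ideal.Quotient.mkₐ K (relIdeal K ρ)).toLinearMap := by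
    refine (PathAlgebra.pathBasis K).ext fun q => ?_
    have h2 : (Ideal.Quotient.mkₐ K (relIdeal K ρ)).toLinearMap (PathAlgebra.pathBasis K q) =
      cls K ρ q.2.2 := rfl
    rw [LinearMap.comp_apply, h2, coeff, liftPaths_cls, Module.Basis.coord_apply,
      Module.Basis.repr_self, Finsupp.single_apply]
    simp [hp]
  exact LinearMap.congr_fun this x

theorem coeff_ext {x y : MonomialAlgebra K ρ}
    (h : ∀ (a b : V) (p : Quiver.Path a b), ¬ Bad ρ p → coeff K ρ p x = coeff K ρ p y) :
    x = y :=
  sub_eq_zero.1 (eq_zero_of_coeff fun a b p hp => by rw [map_sub, h a b p hp, sub_self])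

/-- Left multiplication by an arrow extends paths at their target. -/
theorem coeff_cons_mul {a b c : V} {p : Quiver.Path a b} {α : b ⟶ c} (h : ¬ Bad ρ (p.cons α))
    (x : MonomialAlgebra K ρ) :
    coeff K ρ (p.cons α) (cls K ρ α.toPath * x) = coeff K ρ p x := by
  have hp : ¬ Bad ρ p := fun h' => h (h'.comp_right α.toPath)
  induction x using cls_induction with
  | zero => simp
  | add x y hx hy => rw [mul_add, map_add, map_add, hx, hy]
  | smul k x hx => rw [mul_smul_comm, map_smul, map_smul, hx]
  | path d e q hq =>
    by_cases hpq : (⟨d, e, q⟩ : AnyPath V) = ⟨a, b, p⟩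
    · cases hpq
      rw [cls_mul_cls, Quiver.Path.comp_toPath_eq_cons, coeff_cls_self h, coeff_cls_self hp]
    · rw [coeff_cls_of_ne hpq]
      by_cases he : e = b
      · subst he
        rw [cls_mul_cls, Quiver.Path.comp_toPath_eq_cons, coeff_cls_of_ne]
        intro h2
        apply hpq
        cases h2
        rfl
      · rw [cls_mul_cls_of_ne _ _ he, map_zero]

theorem coeff_mul_nil {a a' b : V} {p : Quiver.Path a b} (h : a ≠ a')
    (x : MonomialAlgebra K ρ) :
    coeff K ρ p (x * cls K ρ (Quiver.Path.nil : Quiver.Path a' a')) = 0 := by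
  induction x using cls_induction with
  | zero => simp
  | add x y hx hy => rw [add_mul, map_add, hx, hy, add_zero]
  | smul k x hx => rw [smul_mul_assoc, map_smul, hx, smul_zero]
  | path d e q hq =>
    by_cases he : a' = d
    · subst he
      rw [cls_mul_cls, Quiver.Path.nil_comp, coeff_cls_of_ne]
      intro h2
      exact h (congrArg Sigma.fst h2).symm
    · rw [cls_mul_cls_of_ne _ _ he, map_zero]

theorem coeff_nil_mul {a b : V} (p : Quiver.Path a b) (x : MonomialAlgebra K ρ) :
    coeff K ρ p (cls K ρ (Quiver.Path.nil : Quiver.Path b b) * x) = coeff K ρ p x := by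
  induction x using cls_induction with
  | zero => simp
  | add x y hx hy => rw [mul_add, map_add, map_add, hx, hy]
  | smul k x hx => rw [mul_smul_comm, map_smul, map_smul, hx]
  | path d e q hq =>
    by_cases he : e = b
    · subst he
      rw [cls_mul_cls, Quiver.Path.comp_nil]
    · rw [cls_mul_cls_of_ne _ _ he, map_zero, coeff_cls_of_ne]
      intro h2
      cases h2
      exact he rfl

theorem coeff_nil_mul_of_ne {a b c : V} (p : Quiver.Path a b) (h : c ≠ b)
    (x : MonomialAlgebra K ρ) :
    coeff K ρ p (cls K ρ (Quiver.Path.nil : Quiver.Path c c) * x) = 0 := by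
  have h1 : cls K ρ (Quiver.Path.nil : Quiver.Path b b) *
      cls K ρ (Quiver.Path.nil : Quiver.Path c c) = 0 := cls_mul_cls_of_ne _ _ h
  rw [← coeff_nil_mul, ← mul_assoc, h1, zero_mul, map_zero]

variable (K ρ) in
/-- Good paths are linearly independent. -/
theorem linearIndependent_cls :
    LinearIndependent K fun p : {p : AnyPath V // ¬ Bad ρ p.2.2} => cls K ρ p.1.2.2 := by
  rw [linearIndependent_iff']
  intro s g hg p hp
  have h2 := congrArg (coeff K ρ p.1.2.2) hg
  rw [map_sum, map_zero, Finset.sum_eq_single p, map_smul, coeff_cls_self p.2, smul_eq_mul,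
    mul_one] at h2
  · exact h2
  · intro q _ hq
    rw [map_smul, coeff_cls_of_ne, smul_zero]
    exact fun h => hq (Subtype.ext h)
  · exact fun h => absurd hp h

variable (K ρ) in
/-- In a finite dimensional monomial algebra the lengths of good paths are bounded. -/
theorem exists_length_lt [Module.Finite K (MonomialAlgebra K ρ)] :
    ∃ N : ℕ, ∀ (a b : V) (p : Quiver.Path a b), ¬ Bad ρ p → p.length < N := by
  have := (linearIndependent_cls K ρ).finite
  obtain ⟨N, hN⟩ := (Set.finite_range
    fun p : {p : AnyPath V // ¬ Bad ρ p.2.2} => p.1.len).bddAbove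
  exact ⟨N + 1, fun a b p hp => Nat.lt_succ_of_le (hN ⟨⟨⟨a, b, p⟩, hp⟩, rfl⟩)⟩

/-! ### The filtration by path length -/

variable (K ρ) in
/-- The span of the paths of length at least `k`. -/
def lengthFiltration (k : ℕ) : Submodule K (MonomialAlgebra K ρ) :=
  Submodule.span K {x | ∃ (a b : V) (p : Quiver.Path a b), k ≤ p.length ∧ x = cls K ρ p}

theorem cls_mem_lengthFiltration {k : ℕ} {a b : V} {p : Quiver.Path a b} (h : k ≤ p.length) :
    cls K ρ p ∈ lengthFiltration K ρ k :=
  Submodule.subset_span ⟨a, b, p, h, rfl⟩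

theorem mem_lengthFiltration_zero (x : MonomialAlgebra K ρ) : x ∈ lengthFiltration K ρ 0 := by
  induction x using cls_induction with
  | zero => exact zero_mem _
  | add x y hx hy => exact add_mem hx hy
  | smul k x hx => exact Submodule.smul_mem _ _ hx
  | path a b p hp => exact cls_mem_lengthFiltration (Nat.zero_le _)

theorem mul_mem_lengthFiltration {i j : ℕ} {x y : MonomialAlgebra K ρ}
    (hx : x ∈ lengthFiltration K ρ i) (hy : y ∈ lengthFiltration K ρ j) :
    x * y ∈ lengthFiltration K ρ (i + j) := by
  induction hx using Submodule.span_induction with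
  | zero => rw [zero_mul]; exact zero_mem _
  | add x x' _ _ hx hx' => rw [add_mul]; exact add_mem hx hx'
  | smul c x _ hx => rw [smul_mul_assoc]; exact Submodule.smul_mem _ _ hx
  | mem x hx =>
  induction hy using Submodule.span_induction with
  | zero => rw [mul_zero]; exact zero_mem _
  | add x x' _ _ hx hx' => rw [mul_add]; exact add_mem hx hx'
  | smul c x _ hx => rw [mul_smul_comm]; exact Submodule.smul_mem _ _ hx
  | mem y hy =>
  obtain ⟨b', c, p, hp, rfl⟩ := hx
  obtain ⟨a, b, q, hq, rfl⟩ := hy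
  by_cases hb : b = b'
  · subst hb
    rw [cls_mul_cls]
    exact cls_mem_lengthFiltration (by rw [Quiver.Path.length_comp]; omega)
  · rw [cls_mul_cls_of_ne _ _ hb]
    exact zero_mem _

theorem mul_mem_lengthFiltration_left (x : MonomialAlgebra K ρ) {j : ℕ} {y : MonomialAlgebra K ρ}
    (hy : y ∈ lengthFiltration K ρ j) : x * y ∈ lengthFiltration K ρ j := by
  simpa using mul_mem_lengthFiltration (mem_lengthFiltration_zero x) hy

theorem mul_mem_lengthFiltration_right {j : ℕ} {y : MonomialAlgebra K ρ}
    (hy : y ∈ lengthFiltration K ρ j) (x : MonomialAlgebra K ρ) :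
    y * x ∈ lengthFiltration K ρ j := by
  simpa using mul_mem_lengthFiltration hy (mem_lengthFiltration_zero x)

/-- The `n`-th power lies in step `n` of the filtration, which vanishes once `n` exceeds all lengths
of good paths. Step 1 thus plays the role of the radical. -/
theorem isNilpotent_of_mem_lengthFiltration [Module.Finite K (MonomialAlgebra K ρ)]
    {x : MonomialAlgebra K ρ} (hx : x ∈ lengthFiltration K ρ 1) : IsNilpotent x := by
  obtain ⟨N, hN⟩ := exists_length_lt K ρ
  have h (n : ℕ) : x ^ n ∈ lengthFiltration K ρ n := by
    induction n with
    | zero => exact mem_lengthFiltration_zero _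
    | succ n ih => rw [pow_succ]; exact mul_mem_lengthFiltration ih hx
  refine ⟨N, ?_⟩
  have h0 : lengthFiltration K ρ N = ⊥ := by
    rw [lengthFiltration, Submodule.span_eq_bot]
    rintro _ ⟨a, b, p, hp, rfl⟩
    refine cls_eq_zero ?_
    by_contra hb
    have := hN a b p hb
    omega
  simpa [h0] using h N

/-! ### The characters of a monomial algebra -/

/-- The coefficients at stationary paths are multiplicative. -/
theorem coeff_nil_map_mul (a : V) (x y : MonomialAlgebra K ρ) :
    coeff K ρ (Quiver.Path.nil : Quiver.Path a a) (x * y) =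
      coeff K ρ (Quiver.Path.nil : Quiver.Path a a) x *
        coeff K ρ (Quiver.Path.nil : Quiver.Path a a) y := by
  have hnil {b c : V} (p : Quiver.Path b c) (h : p.length ≠ 0) :
      coeff K ρ (Quiver.Path.nil : Quiver.Path a a) (cls K ρ p) = 0 := by
    apply coeff_cls_of_ne
    intro h2
    cases h2
    exact h rfl
  induction x using cls_induction with
  | zero => simp
  | add x x' hx hx' => rw [add_mul, map_add, map_add, hx, hx', add_mul]
  | smul c x hx => rw [smul_mul_assoc, map_smul, map_smul, hx, smul_mul_assoc]
  | path b c p hp =>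
    by_cases h : p.length = 0
    · obtain rfl := p.eq_of_length_zero h
      obtain rfl := p.eq_nil_of_length_zero h
      by_cases hab : b = a
      · subst hab
        rw [coeff_nil_mul, coeff_cls_self hp, one_mul]
      · rw [coeff_nil_mul_of_ne _ hab, coeff_cls_of_ne, zero_mul]
        intro h2
        exact hab (congrArg Sigma.fst h2)
    · rw [hnil p h, zero_mul]
      induction y using cls_induction with
      | zero => simp
      | add x x' hx hx' => rw [mul_add, map_add, hx, hx', add_zero]
      | smul c x hx => rw [mul_smul_comm, map_smul, hx, smul_zero]
      | path d e q hq =>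
        by_cases he : e = b
        · subst he
          rw [cls_mul_cls]
          exact hnil _ (by rw [Quiver.Path.length_comp]; omega)
        · rw [cls_mul_cls_of_ne _ _ he, map_zero]

variable (K) in
/-- The character of the monomial algebra given by the coefficient at a stationary path. -/
def character (hρ : ∀ p ∈ ρ, 2 ≤ p.len) (a : V) : MonomialAlgebra K ρ →ₐ[K] K :=
  AlgHom.ofLinearMap (coeff K ρ (Quiver.Path.nil : Quiver.Path a a))
    (by
      rw [one_eq_sum_cls_nil, map_sum, Finset.sum_eq_single a]
      · exact coeff_cls_self (not_bad_of_length_lt hρ (by simp))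
      · intro b _ hb
        refine coeff_cls_of_ne fun h => hb (congrArg Sigma.fst h)
      · exact fun h => absurd (Finset.mem_univ a) h)
    (coeff_nil_map_mul a)

variable (hρ : ∀ p ∈ ρ, 2 ≤ p.len)

theorem character_cls_nil (a : V) :
    character K hρ a (cls K ρ (Quiver.Path.nil : Quiver.Path a a)) = 1 :=
  coeff_cls_self (not_bad_of_length_lt hρ (by simp))

theorem character_cls_nil_of_ne {a b : V} (h : b ≠ a) :
    character K hρ a (cls K ρ (Quiver.Path.nil : Quiver.Path b b)) = 0 :=
  coeff_cls_of_ne fun h' => h (congrArg Sigma.fst h')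

theorem character_cls_of_length_ne_zero (a : V) {b c : V} {p : Quiver.Path b c}
    (h : p.length ≠ 0) : character K hρ a (cls K ρ p) = 0 := by
  refine coeff_cls_of_ne fun h' => ?_
  cases h'
  exact h rfl

/-- Modulo paths of positive length, `x e_a` is a multiple of `e_a`. -/
theorem mul_nil_sub_mem_lengthFiltration (a : V) (x : MonomialAlgebra K ρ) :
    x * cls K ρ (Quiver.Path.nil : Quiver.Path a a) -
      character K hρ a x • cls K ρ (Quiver.Path.nil : Quiver.Path a a) ∈
        lengthFiltration K ρ 1 := by
  induction x using cls_induction with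
  | zero => simp
  | add x y hx hy =>
    convert add_mem hx hy using 1
    rw [map_add, add_mul, add_smul]; abel
  | smul c x hx =>
    convert Submodule.smul_mem _ c hx using 1
    rw [map_smul, smul_mul_assoc, smul_sub, smul_assoc]
  | path b c p hp =>
    by_cases h : p.length = 0
    · obtain rfl := p.eq_of_length_zero h
      obtain rfl := p.eq_nil_of_length_zero h
      by_cases hab : a = b
      · subst hab
        rw [cls_mul_cls, character_cls_nil, one_smul, Quiver.Path.comp_nil, sub_self]
        exact zero_mem _
      · rw [cls_mul_cls_of_ne _ _ hab, character_cls_nil_of_ne hρ (Ne.symm hab), zero_smul,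
          sub_zero]
        exact zero_mem _
    · rw [character_cls_of_length_ne_zero hρ a h, zero_smul, sub_zero]
      exact mul_mem_lengthFiltration_right (cls_mem_lengthFiltration (by omega)) _

end MonomialAlgebra

/-! ### Socles and projective covers -/

section Rings

variable {R : Type u} [Ring R]

theorem le_socle {M : Type v} [AddCommGroup M] [Module R M] {N : Submodule R M}
    (h : IsSimpleModule R N) : N ≤ socle R M :=
  le_sSup h

theorem map_socle_le {M : Type v} {N : Type w} [AddCommGroup M] [Module R M] [AddCommGroup N]
    [Module R N] (f : M →ₗ[R] N) (hf : Function.Injective f) :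
    (socle R M).map f ≤ socle R N := by
  rw [Submodule.map_le_iff_le_comap]
  refine sSup_le fun L hL => ?_
  rw [← Submodule.map_le_iff_le_comap]
  have : IsSimpleModule R L := hL
  exact le_socle (IsSimpleModule.congr (Submodule.equivMapOfInjective f hf L).symm)

/-- Isomorphic modules have isomorphic socles. -/
def socleEquiv {M : Type v} {N : Type w} [AddCommGroup M] [Module R M] [AddCommGroup N]
    [Module R N] (e : M ≃ₗ[R] N) : socle R M ≃ₗ[R] socle R N :=
  (e.submoduleMap (socle R M)).trans (LinearEquiv.ofEq _ _ (by
    refine le_antisymm (map_socle_le e.toLinearMap e.injective) fun x hx => ?_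
    have h := map_socle_le e.symm.toLinearMap e.symm.injective (Submodule.mem_map_of_mem hx)
    exact ⟨_, h, e.apply_symm_apply x⟩))

/-- Projective covers are unique up to isomorphism. -/
theorem IsProjectiveCover.nonempty_equiv {P P' S : Type v} [AddCommGroup P] [Module R P]
    [AddCommGroup P'] [Module R P'] [AddCommGroup S] [Module R S] {π : P →ₗ[R] S}
    {π' : P' →ₗ[R] S} (h : IsProjectiveCover π) (h' : IsProjectiveCover π') :
    Nonempty (P ≃ₗ[R] P') := by
  have := h.projective
  have := h'.projective
  -- A map over `S` into a projective cover is onto, since its image and the superfluous kernel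
  -- together span everything.
  have key {A B : Type v} [AddCommGroup A] [Module R A] [AddCommGroup B] [Module R B]
      {f : A →ₗ[R] S} {g : B →ₗ[R] S} (hf : Function.Surjective f) (hg : IsProjectiveCover g)
      (φ : A →ₗ[R] B) (hφ : g ∘ₗ φ = f) : Function.Surjective φ := by
    rw [← LinearMap.range_eq_top]
    apply hg.superfluous
    rw [eq_top_iff]
    intro y _
    obtain ⟨x, hx⟩ := hf (g y)
    rw [← hφ] at hx
    refine Submodule.mem_sup.2 ⟨y - φ x, ?_, φ x, ⟨x, rfl⟩, sub_add_cancel _ _⟩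
    rw [LinearMap.mem_ker, map_sub, ← hx, LinearMap.comp_apply, sub_self]
  obtain ⟨φ, hφ⟩ := Module.projective_lifting_property π' π h'.surjective
  have hsurj := key h.surjective h' φ hφ
  -- The section `ψ` of `φ` is also a map over `S`, hence onto, and this makes `φ` injective.
  obtain ⟨ψ, hψ⟩ := Module.projective_lifting_property φ LinearMap.id hsurj
  have hψ' : Function.Surjective ψ := by
    refine key h'.surjective h ψ ?_
    rw [← hφ, LinearMap.comp_assoc, hψ, LinearMap.comp_id]
  refine ⟨LinearEquiv.ofBijective φ ⟨fun x y hxy => ?_, hsurj⟩⟩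
  obtain ⟨x, rfl⟩ := hψ' x
  obtain ⟨y, rfl⟩ := hψ' y
  have h1 (z : P') : φ (ψ z) = z := LinearMap.congr_fun hψ z
  rw [h1, h1] at hxy
  rw [hxy]

end Rings

/-! ### Simple modules over a monomial algebra -/

section Simple

variable {K : Type w} {V : Type u} [Field K] [Quiver.{v} V] [Fintype V] {ρ : Set (AnyPath V)}
  (hρ : ∀ p ∈ ρ, 2 ≤ p.len)

variable (K) in
/-- The algebra acts on the vector `x` through the character at the vertex `a`. -/
def IsEigenvector (a : V) {M : Type*} [AddCommGroup M] [Module (MonomialAlgebra K ρ) M]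
    (x : M) : Prop :=
  x ≠ 0 ∧ ∀ r : MonomialAlgebra K ρ,
    -- The scalar acts through `algebraMap` because `M` has no `K`-module structure of its own.
    r • x = algebraMap K (MonomialAlgebra K ρ) (character K hρ a r) • x

section

variable {hρ} {a b : V} {M N : Type*} [AddCommGroup M] [Module (MonomialAlgebra K ρ) M]
  [AddCommGroup N] [Module (MonomialAlgebra K ρ) N] {x : M}

theorem IsEigenvector.map (h : IsEigenvector K hρ a x) (f : M →ₗ[MonomialAlgebra K ρ] N)
    (hf : Function.Injective f) : IsEigenvector K hρ a (f x) := by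
  refine ⟨fun h0 => h.1 (hf (by rw [h0, map_zero])), fun r => ?_⟩
  rw [← map_smul, h.2, map_smul]

theorem IsEigenvector.algebraMap_smul_eq_zero (h : IsEigenvector K hρ a x) {c : K}
    (hc : algebraMap K (MonomialAlgebra K ρ) c • x = 0) : c = 0 := by
  by_contra h0
  apply h.1
  rw [← one_smul (MonomialAlgebra K ρ) x, ← map_one (algebraMap K _), ← inv_mul_cancel₀ h0,
    map_mul, mul_smul, hc, smul_zero]

theorem IsEigenvector.smul_eq_zero_iff (h : IsEigenvector K hρ a x) (r : MonomialAlgebra K ρ) :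
    r • x = 0 ↔ character K hρ a r = 0 := by
  rw [h.2]
  refine ⟨h.algebraMap_smul_eq_zero, fun h0 => ?_⟩
  rw [h0, map_zero, zero_smul]

theorem IsEigenvector.isSimpleModule (h : IsEigenvector K hρ a x)
    (hx : ∀ y : M, ∃ r : MonomialAlgebra K ρ, r • x = y) :
    IsSimpleModule (MonomialAlgebra K ρ) M := by
  rw [isSimpleModule_iff_toSpanSingleton_surjective]
  refine ⟨⟨x, 0, h.1⟩, fun y hy z => ?_⟩
  obtain ⟨r, rfl⟩ := hx y
  obtain ⟨s, rfl⟩ := hx z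
  have hr : character K hρ a r ≠ 0 := fun h0 => hy ((h.smul_eq_zero_iff r).2 h0)
  refine ⟨s * algebraMap K _ (character K hρ a r)⁻¹, ?_⟩
  rw [LinearMap.toSpanSingleton_apply, h.2 r, smul_smul, mul_assoc, ← map_mul,
    inv_mul_cancel₀ hr, map_one, mul_one]

theorem IsEigenvector.exists_smul_eq [IsSimpleModule (MonomialAlgebra K ρ) M]
    (h : IsEigenvector K hρ a x) (y : M) : ∃ r : MonomialAlgebra K ρ, r • x = y :=
  IsSimpleModule.toSpanSingleton_surjective _ h.1 y

/-- Since `y` is a scalar multiple of `x`, the idempotent at `b` would kill `y` if `a ≠ b`, although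
it fixes `y`. -/
theorem IsEigenvector.vertex_eq [IsSimpleModule (MonomialAlgebra K ρ) M] {y : M}
    (hx : IsEigenvector K hρ a x) (hy : IsEigenvector K hρ b y) : a = b := by
  by_contra hab
  obtain ⟨r, rfl⟩ := hx.exists_smul_eq y
  have h1 := hy.2 (cls K ρ (Quiver.Path.nil : Quiver.Path b b))
  rw [character_cls_nil, map_one, one_smul, hx.2 r, smul_smul, ← Algebra.commutes, mul_smul,
    hx.2 (cls K ρ (Quiver.Path.nil : Quiver.Path b b)), character_cls_nil_of_ne hρ (Ne.symm hab), map_zero, zero_smul,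
    smul_zero, ← hx.2 r] at h1
  exact hy.1 h1.symm

/-- Both modules are cyclic on a vector whose annihilator is the kernel of the character at `a`. -/
theorem IsEigenvector.nonempty_equiv [IsSimpleModule (MonomialAlgebra K ρ) M]
    [IsSimpleModule (MonomialAlgebra K ρ) N] {y : N} (hx : IsEigenvector K hρ a x)
    (hy : IsEigenvector K hρ a y) : Nonempty (M ≃ₗ[MonomialAlgebra K ρ] N) := by
  have hker : LinearMap.ker (LinearMap.toSpanSingleton (MonomialAlgebra K ρ) M x) =
      LinearMap.ker (LinearMap.toSpanSingleton (MonomialAlgebra K ρ) N y) := by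
    ext r
    rw [LinearMap.mem_ker, LinearMap.mem_ker, LinearMap.toSpanSingleton_apply,
      LinearMap.toSpanSingleton_apply, hx.smul_eq_zero_iff, hy.smul_eq_zero_iff]
  exact ⟨((LinearMap.quotKerEquivOfSurjective
    (LinearMap.toSpanSingleton (MonomialAlgebra K ρ) M x) hx.exists_smul_eq).symm.trans
    (Submodule.quotEquivOfEq _ _ hker)).trans
      (LinearMap.quotKerEquivOfSurjective
        (LinearMap.toSpanSingleton (MonomialAlgebra K ρ) N y) hy.exists_smul_eq)⟩

theorem IsEigenvector.isSimpleModule_span (h : IsEigenvector K hρ a x) :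
    IsSimpleModule (MonomialAlgebra K ρ) (Submodule.span (MonomialAlgebra K ρ) {x}) := by
  have h' : IsEigenvector K hρ a (⟨x, Submodule.mem_span_singleton_self x⟩ :
      Submodule.span (MonomialAlgebra K ρ) {x}) :=
    ⟨fun h0 => h.1 (congrArg Subtype.val h0), fun r => Subtype.ext (h.2 r)⟩
  refine h'.isSimpleModule fun ⟨y, hy⟩ => ?_
  obtain ⟨r, hr⟩ := Submodule.mem_span_singleton.1 hy
  exact ⟨r, Subtype.ext hr⟩

theorem IsEigenvector.mem_socle (h : IsEigenvector K hρ a x) :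
    x ∈ socle (MonomialAlgebra K ρ) M :=
  le_socle h.isSimpleModule_span (Submodule.mem_span_singleton_self x)

/-- Modulo paths of positive length, `r e_a` is the character value of `r` times `e_a`, and `e_a`
fixes `x`. -/
theorem isEigenvector_of_annihilated (hx0 : x ≠ 0)
    (hx : ∀ j ∈ lengthFiltration K ρ 1, j • x = 0)
    (ha : cls K ρ (Quiver.Path.nil : Quiver.Path a a) • x = x) : IsEigenvector K hρ a x := by
  refine ⟨hx0, fun r => ?_⟩
  have h := hx _ (mul_nil_sub_mem_lengthFiltration hρ a r)
  rwa [sub_smul, mul_smul, ha, Algebra.smul_def, mul_smul, ha, sub_eq_zero] at h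

/-- Paths of positive length annihilate simple modules. -/
theorem smul_eq_zero_of_isSimpleModule [Module.Finite K (MonomialAlgebra K ρ)]
    [IsSimpleModule (MonomialAlgebra K ρ) M] {j : MonomialAlgebra K ρ}
    (hj : j ∈ lengthFiltration K ρ 1) (x : M) : j • x = 0 := by
  by_contra h
  -- If `j • x ≠ 0`, simplicity gives `r` with `r j x = x`, which contradicts nilpotence of `r * j`.
  obtain ⟨r, hr⟩ := IsSimpleModule.toSpanSingleton_surjective (MonomialAlgebra K ρ) h x
  rw [LinearMap.toSpanSingleton_apply, smul_smul] at hr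
  obtain ⟨n, hn⟩ := isNilpotent_of_mem_lengthFiltration (mul_mem_lengthFiltration_left r hj)
  have h2 (n : ℕ) : (r * j) ^ n • x = x := by
    induction n with
    | zero => simp
    | succ n ih => rw [pow_succ, mul_smul, hr, ih]
  have h3 := h2 n
  rw [hn, zero_smul] at h3
  exact h (by rw [← h3, smul_zero])

variable (K hρ M) in
-- The stationary paths sum to one, so one of them does not kill a given non-zero vector, and its
-- image is the eigenvector.
theorem exists_isEigenvector [Module.Finite K (MonomialAlgebra K ρ)]
    [IsSimpleModule (MonomialAlgebra K ρ) M] : ∃ (a : V) (x : M), IsEigenvector K hρ a x := by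
  have := IsSimpleModule.nontrivial (MonomialAlgebra K ρ) M
  obtain ⟨x, hx⟩ := exists_ne (0 : M)
  obtain ⟨a, ha⟩ : ∃ a : V, cls K ρ (Quiver.Path.nil : Quiver.Path a a) • x ≠ 0 := by
    by_contra! h
    apply hx
    rw [← one_smul (MonomialAlgebra K ρ) x, one_eq_sum_cls_nil, Finset.sum_smul]
    exact Finset.sum_eq_zero fun a _ => h a
  refine ⟨a, _, isEigenvector_of_annihilated ha
    (fun j hj => smul_eq_zero_of_isSimpleModule hj _) ?_⟩
  rw [smul_smul, cls_mul_cls, Quiver.Path.comp_nil]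

/-- Paths of positive length annihilate the socle. -/
theorem smul_eq_zero_of_mem_socle [Module.Finite K (MonomialAlgebra K ρ)]
    {j : MonomialAlgebra K ρ} (hj : j ∈ lengthFiltration K ρ 1)
    (hx : x ∈ socle (MonomialAlgebra K ρ) M) : j • x = 0 := by
  let A : Submodule (MonomialAlgebra K ρ) M :=
    { carrier := {x | ∀ j ∈ lengthFiltration K ρ 1, j • x = 0}
      zero_mem' := fun j _ => smul_zero j
      add_mem' := fun {x y} hx hy j hj => by rw [smul_add, hx j hj, hy j hj, add_zero]
      smul_mem' := fun r x hx j hj => by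
        rw [smul_smul]
        exact hx _ (mul_mem_lengthFiltration_right hj r) }
  have : socle (MonomialAlgebra K ρ) M ≤ A := sSup_le fun L hL y hy j hj => by
    have : IsSimpleModule (MonomialAlgebra K ρ) L := hL
    exact congrArg Subtype.val (smul_eq_zero_of_isSimpleModule hj (⟨y, hy⟩ : L))
  exact this hx j hj

end

variable (K) in
theorem isEigenvector_quotient (a : V) :
    IsEigenvector K hρ a (Submodule.Quotient.mk 1 :
      MonomialAlgebra K ρ ⧸ (RingHom.ker (character K hρ a) : Ideal (MonomialAlgebra K ρ))) := by
  constructor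
  · rw [Ne, Submodule.Quotient.mk_eq_zero, RingHom.mem_ker, map_one]
    exact one_ne_zero
  · intro r
    rw [← Submodule.Quotient.mk_smul, ← Submodule.Quotient.mk_smul, Submodule.Quotient.eq,
      RingHom.mem_ker, smul_eq_mul, smul_eq_mul, mul_one, mul_one, map_sub, AlgHom.commutes]
    exact sub_self _

variable (K) in
/-- The simple module at a vertex. -/
def simpleAt (a : V) : SimpleMod (MonomialAlgebra K ρ) where
  carrier := MonomialAlgebra K ρ ⧸ (RingHom.ker (character K hρ a) : Ideal (MonomialAlgebra K ρ))
  isSimple := (isEigenvector_quotient K hρ a).isSimpleModule fun y => by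
    obtain ⟨r, rfl⟩ := Submodule.Quotient.mk_surjective _ y
    exact ⟨r, by rw [← Submodule.Quotient.mk_smul, smul_eq_mul, mul_one]⟩

variable {hρ} in
theorem IsEigenvector.isoClass_eq {a : V} {S : SimpleMod (MonomialAlgebra K ρ)} {x : S.carrier}
    (h : IsEigenvector K hρ a x) : S.isoClass = (simpleAt K hρ a).isoClass :=
  have := (simpleAt K hρ a).isSimple
  Quotient.sound (h.nonempty_equiv (N := (simpleAt K hρ a).carrier)
    (isEigenvector_quotient K hρ a))

/-- The simple modules are classified by the vertices. -/
theorem bijective_isoClass_simpleAt [Module.Finite K (MonomialAlgebra K ρ)] :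
    Function.Bijective fun a : V => (simpleAt K hρ a).isoClass := by
  constructor
  · intro a b hab
    obtain ⟨e⟩ : Nonempty ((simpleAt K hρ a).carrier ≃ₗ[MonomialAlgebra K ρ]
      (simpleAt K hρ b).carrier) := Quotient.exact hab
    have h1 : IsEigenvector K hρ a (e (Submodule.Quotient.mk 1)) :=
      (isEigenvector_quotient K hρ a).map e.toLinearMap e.injective
    have := (simpleAt K hρ b).isSimple
    exact h1.vertex_eq (isEigenvector_quotient K hρ b)
  · intro c
    induction c using Quotient.inductionOn with
    | h S =>
      obtain ⟨a, x, hx⟩ := exists_isEigenvector K hρ S.carrier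
      exact ⟨a, hx.isoClass_eq.symm⟩

/-! ### Indecomposable projective modules -/

variable (K ρ) in
/-- The indecomposable projective module at a vertex. -/
def projectiveAt (a : V) : Ideal (MonomialAlgebra K ρ) :=
  Ideal.span {cls K ρ (Quiver.Path.nil : Quiver.Path a a)}

theorem cls_nil_mul_self (a : V) :
    cls K ρ (Quiver.Path.nil : Quiver.Path a a) * cls K ρ (Quiver.Path.nil : Quiver.Path a a) =
      cls K ρ (Quiver.Path.nil : Quiver.Path a a) := by
  rw [cls_mul_cls, Quiver.Path.comp_nil]

theorem mem_projectiveAt_iff {a : V} {x : MonomialAlgebra K ρ} :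
    x ∈ projectiveAt K ρ a ↔ x * cls K ρ (Quiver.Path.nil : Quiver.Path a a) = x := by
  rw [projectiveAt, Ideal.mem_span_singleton']
  constructor
  · rintro ⟨y, rfl⟩
    rw [mul_assoc, cls_nil_mul_self]
  · exact fun h => ⟨x, h⟩

theorem cls_mem_projectiveAt {a b : V} (p : Quiver.Path a b) :
    cls K ρ p ∈ projectiveAt K ρ a :=
  mem_projectiveAt_iff.2 (by rw [cls_mul_cls, Quiver.Path.nil_comp])

theorem projective_projectiveAt (a : V) :
    Module.Projective (MonomialAlgebra K ρ) (projectiveAt K ρ a) := by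
  refine Module.Projective.of_split (Submodule.subtype _)
    (LinearMap.toSpanSingleton (MonomialAlgebra K ρ) (projectiveAt K ρ a)
      ⟨_, cls_mem_projectiveAt .nil⟩) ?_
  ext x
  exact mem_projectiveAt_iff.1 x.2

theorem exists_isProjectiveCover [Module.Finite K (MonomialAlgebra K ρ)] {a : V}
    {S : Type (max u v w)} [AddCommGroup S] [Module (MonomialAlgebra K ρ) S]
    [IsSimpleModule (MonomialAlgebra K ρ) S] {x : S} (hx : IsEigenvector K hρ a x) :
    ∃ π : projectiveAt K ρ a →ₗ[MonomialAlgebra K ρ] S, IsProjectiveCover π := by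
  refine ⟨LinearMap.toSpanSingleton (MonomialAlgebra K ρ) S x ∘ₗ Submodule.subtype _,
    projective_projectiveAt a, fun y => ?_, fun N hN => ?_⟩
  · obtain ⟨r, rfl⟩ := hx.exists_smul_eq y
    refine ⟨r • ⟨_, cls_mem_projectiveAt .nil⟩, ?_⟩
    simp only [map_smul, LinearMap.comp_apply, Submodule.subtype_apply,
      LinearMap.toSpanSingleton_apply]
    rw [hx.2 (cls K ρ .nil), character_cls_nil, map_one, one_smul]
  · have he : (⟨_, cls_mem_projectiveAt .nil⟩ : projectiveAt K ρ a) ∈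
        (⊤ : Submodule (MonomialAlgebra K ρ) (projectiveAt K ρ a)) := trivial
    rw [← hN] at he
    obtain ⟨⟨k, hk⟩, hk0, ⟨n, hn⟩, hnN, hkn⟩ := Submodule.mem_sup.1 he
    replace hkn : k + n = cls K ρ .nil := congrArg Subtype.val hkn
    replace hk0 : k • x = 0 := hk0
    rw [hx.smul_eq_zero_iff] at hk0
    -- The kernel component `k` has character zero and satisfies `k e_a = k`, so it is nilpotent. As
    -- `n = (1 - k) e_a` with `1 - k` a unit, `n` already generates the projective.
    have hkF := mul_nil_sub_mem_lengthFiltration hρ a k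
    rw [hk0, zero_smul, sub_zero, mem_projectiveAt_iff.1 hk] at hkF
    obtain ⟨y, hy⟩ := (isNilpotent_of_mem_lengthFiltration hkF).isUnit_one_sub.exists_left_inv
    have hyn : y * n = cls K ρ (Quiver.Path.nil : Quiver.Path a a) := by
      rw [eq_sub_of_add_eq' hkn]
      have h1 := sub_mul 1 k (cls K ρ (Quiver.Path.nil : Quiver.Path a a))
      rw [one_mul, mem_projectiveAt_iff.1 hk] at h1
      rw [← h1, ← mul_assoc, hy, one_mul]
    rw [eq_top_iff]
    intro z _
    have : z = (z.1 * y) • (⟨n, hn⟩ : projectiveAt K ρ a) := by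
      apply Subtype.ext
      change z.1 = z.1 * y * n
      rw [mul_assoc, hyn, mem_projectiveAt_iff.1 z.2]
    rw [this]
    exact N.smul_mem _ hnN

end Simple

/-! ### Maximal good paths -/

section Maximal

variable {V : Type u} [Quiver.{v} V]

/-- A good path is maximal if it cannot be prolonged at its target to a good path. -/
def IsMaximalPath (ρ : Set (AnyPath V)) {a b : V} (p : Quiver.Path a b) : Prop :=
  ¬ Bad ρ p ∧ ∀ (c : V) (α : b ⟶ c), Bad ρ (p.cons α)

/-- A maximal good path is determined by its target. -/
def TargetDeterminesMaximalPath (ρ : Set (AnyPath V)) : Prop :=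
  ∀ (a a' b : V) (p : Quiver.Path a b) (q : Quiver.Path a' b), IsMaximalPath ρ p →
    IsMaximalPath ρ q → (⟨a, b, p⟩ : AnyPath V) = ⟨a', b, q⟩

/-- Keep adding arrows while the path stays good; the bound `N` stops the process, so the induction
is on `N - p.length`. -/
theorem exists_isMaximalPath_comp {ρ : Set (AnyPath V)} {N : ℕ}
    (hN : ∀ (a b : V) (p : Quiver.Path a b), ¬ Bad ρ p → p.length < N) {a b : V}
    (p : Quiver.Path a b) (hp : ¬ Bad ρ p) :
    ∃ (c : V) (q : Quiver.Path b c), IsMaximalPath ρ (p.comp q) := by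
  obtain ⟨n, hn⟩ : ∃ n, n = N - p.length := ⟨_, rfl⟩
  induction n generalizing b with
  | zero =>
    have := hN _ _ p hp
    omega
  | succ n ih =>
    by_cases h : ∀ (c : V) (α : b ⟶ c), Bad ρ (p.cons α)
    · exact ⟨b, .nil, hp, h⟩
    · push Not at h
      obtain ⟨c, α, hα⟩ := h
      obtain ⟨d, q, hq⟩ := ih (p.cons α) hα (by rw [Quiver.Path.length_cons]; omega)
      refine ⟨d, α.toPath.comp q, ?_⟩
      rwa [← Quiver.Path.comp_assoc, Quiver.Path.comp_toPath_eq_cons]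

/-- Maximal paths from different vertices have different targets, so on a finite vertex set `T` is
bijective. Any maximal path from `a` then shares its target with some `P a'`, hence equals it, and
`a' = a`. -/
theorem TargetDeterminesMaximalPath.exists_maximal [Fintype V] {ρ : Set (AnyPath V)}
    (hρ : ∀ p ∈ ρ, 2 ≤ p.len) (h : TargetDeterminesMaximalPath ρ) {N : ℕ}
    (hN : ∀ (a b : V) (p : Quiver.Path a b), ¬ Bad ρ p → p.length < N) :
    ∃ (T : V → V) (P : ∀ a, Quiver.Path a (T a)), Function.Injective T ∧
      (∀ a, IsMaximalPath ρ (P a)) ∧ ∀ (a b : V) (q : Quiver.Path a b), IsMaximalPath ρ q →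
        (⟨b, q⟩ : Σ b, Quiver.Path a b) = ⟨T a, P a⟩ := by
  have h1 (a : V) : ∃ (c : V) (q : Quiver.Path a c), IsMaximalPath ρ q := by
    obtain ⟨c, q, hq⟩ := exists_isMaximalPath_comp hN (Quiver.Path.nil : Quiver.Path a a)
      (not_bad_of_length_lt hρ (by simp))
    exact ⟨c, q, by rwa [Quiver.Path.nil_comp] at hq⟩
  choose T P hP using h1
  have key (a a' : V) (q : Quiver.Path a' (T a)) (hq : IsMaximalPath ρ q) :
      (⟨a', T a, q⟩ : AnyPath V) = ⟨a, T a, P a⟩ := h _ _ _ _ _ hq (hP a)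
  have hT : Function.Injective T := by
    intro a a' haa
    obtain ⟨q, hq⟩ : ∃ q : Quiver.Path a (T a'), IsMaximalPath ρ q := haa ▸ ⟨P a, hP a⟩
    have h2 := key a' a q hq
    exact congrArg Sigma.fst h2
  refine ⟨T, P, hT, hP, fun a b q hq => ?_⟩
  obtain ⟨a', rfl⟩ := (Finite.injective_iff_surjective.1 hT) b
  have h2 := key a' a q hq
  obtain rfl : a = a' := congrArg Sigma.fst h2
  simpa using h2

end Maximal

/-! ### Maximal paths, socle-injectivity and the Nakayama permutation -/

section Conditions

variable {K : Type w} {V : Type u} [Field K] [Quiver.{v} V] [Fintype V] {ρ : Set (AnyPath V)}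
  {hρ : ∀ p ∈ ρ, 2 ≤ p.len}

variable (K hρ) in
theorem IsMaximalPath.isEigenvector {a b : V} {p : Quiver.Path a b} (hp : IsMaximalPath ρ p) :
    IsEigenvector K hρ b (cls K ρ p) := by
  refine isEigenvector_of_annihilated (cls_ne_zero hp.1) (fun j hj => ?_) ?_
  · induction hj using Submodule.span_induction with
    | zero => exact zero_smul _ _
    | add x y _ _ hx hy => rw [add_smul, hx, hy, add_zero]
    | smul c x _ hx => rw [smul_assoc, hx, smul_zero]
    | mem x hx =>
      obtain ⟨c, d, q, hq, rfl⟩ := hx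
      rw [smul_eq_mul]
      by_cases hbc : b = c
      · subst hbc
        obtain ⟨e, α, r, rfl, -⟩ :=
          (Quiver.Path.length_ne_zero_iff_eq_comp q).1 (by omega)
        rw [cls_mul_cls]
        apply cls_eq_zero
        rw [← Quiver.Path.comp_assoc]
        exact (hp.2 e α).comp_right r
      · exact cls_mul_cls_of_ne _ _ hbc
  · rw [smul_eq_mul, cls_mul_cls, Quiver.Path.comp_nil]

variable (hρ) in
-- Only the stationary part of `r` acts on `x`. This makes coefficient functionals semilinear along
-- a character, which gives module maps out of the socle.
theorem coeff_mul_of_annihilated {x : MonomialAlgebra K ρ}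
    (hx : ∀ j ∈ lengthFiltration K ρ 1, j * x = 0) {a b : V} (p : Quiver.Path a b)
    (r : MonomialAlgebra K ρ) : coeff K ρ p (r * x) = character K hρ b r * coeff K ρ p x := by
  induction r using cls_induction with
  | zero => simp
  | add r s hr hs => rw [add_mul, map_add, map_add, hr, hs, add_mul]
  | smul c r hr => rw [smul_mul_assoc, map_smul, map_smul, hr, smul_mul_assoc]
  | path c d q hq =>
    by_cases h : q.length = 0
    · obtain rfl := q.eq_of_length_zero h
      obtain rfl := q.eq_nil_of_length_zero h
      by_cases hcb : c = b
      · subst hcb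
        rw [coeff_nil_mul, character_cls_nil, one_mul]
      · rw [coeff_nil_mul_of_ne _ hcb, character_cls_nil_of_ne hρ hcb, zero_mul]
    · rw [hx _ (cls_mem_lengthFiltration (by omega)), character_cls_of_length_ne_zero hρ b h,
        map_zero, zero_mul]

/-- Every path occurring in `cls K ρ p * y` runs through `p` last. -/
theorem exists_comp_eq_of_cls_mul_eq {a b a' : V} {p : Quiver.Path a b} {q : Quiver.Path a' b}
    (hq : ¬ Bad ρ q) {y : MonomialAlgebra K ρ} (h : cls K ρ p * y = cls K ρ q) :
    ∃ r : Quiver.Path a' a, q = r.comp p := by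
  by_contra! hr
  have h0 : coeff K ρ q (cls K ρ p * y) = 0 := by
    clear h
    induction y using cls_induction with
    | zero => simp
    | add x y hx hy => rw [mul_add, map_add, hx, hy, add_zero]
    | smul c x hx => rw [mul_smul_comm, map_smul, hx, smul_zero]
    | path c d r _ =>
      by_cases hd : d = a
      · subst hd
        rw [cls_mul_cls]
        apply coeff_cls_of_ne
        intro h2
        obtain rfl : c = a' := congrArg Sigma.fst h2
        exact hr r (by simpa using h2.symm)
      · rw [cls_mul_cls_of_ne _ _ hd, map_zero]
  rw [h, coeff_cls_self hq] at h0
  exact one_ne_zero h0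

theorem IsSocleInjective.targetDeterminesMaximalPath (hρ : ∀ p ∈ ρ, 2 ≤ p.len)
    [Module.Finite K (MonomialAlgebra K ρ)]
    (h : IsSocleInjective (MonomialAlgebra K ρ)) : TargetDeterminesMaximalPath ρ := by
  have key (a a' b : V) (p : Quiver.Path a b) (q : Quiver.Path a' b) (hp : IsMaximalPath ρ p)
      (hq : IsMaximalPath ρ q) : ∃ r : Quiver.Path a' a, q = r.comp p := by
    -- Linearity uses that `p` and `q` share the target `b`: the algebra acts on both sides through
    -- the character at `b`.
    let f : socle (MonomialAlgebra K ρ) (MonomialAlgebra K ρ) →ₗ[MonomialAlgebra K ρ]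
        MonomialAlgebra K ρ :=
      { toFun := fun x => coeff K ρ p (x : MonomialAlgebra K ρ) • cls K ρ q
        map_add' := fun x y => by rw [Submodule.coe_add, map_add, add_smul]
        map_smul' := fun r x => by
          rw [Submodule.coe_smul, smul_eq_mul, coeff_mul_of_annihilated hρ
            (fun j hj => smul_eq_zero_of_mem_socle hj x.2), RingHom.id_apply, smul_comm r,
            (hq.isEigenvector K hρ).2 r, smul_eq_mul, ← Algebra.smul_def, smul_smul, mul_comm] }
    obtain ⟨g, hg⟩ := h f
    have h1 := hg ⟨cls K ρ p, (hp.isEigenvector K hρ).mem_socle⟩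
    have h2 : g (cls K ρ p) = cls K ρ p * g 1 := by rw [← smul_eq_mul, ← map_smul, smul_eq_mul,
      mul_one]
    have h3 : f ⟨cls K ρ p, (hp.isEigenvector K hρ).mem_socle⟩ = cls K ρ q := by
      change coeff K ρ p (cls K ρ p) • cls K ρ q = cls K ρ q
      rw [coeff_cls_self hp.1, one_smul]
    rw [h3, h2] at h1
    exact exists_comp_eq_of_cls_mul_eq hq.1 h1
  -- Each of `p` and `q` is a terminal segment of the other, so the complementary pieces have length
  -- zero.
  intro a a' b p q hp hq
  obtain ⟨r, hr⟩ := key _ _ _ p q hp hq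
  obtain ⟨s, hs⟩ := key _ _ _ q p hq hp
  have h1 := congrArg Quiver.Path.length hr
  have h2 := congrArg Quiver.Path.length hs
  rw [Quiver.Path.length_comp] at h1 h2
  have h3 : r.length = 0 := by omega
  obtain rfl := r.eq_of_length_zero h3
  obtain rfl := r.eq_nil_of_length_zero h3
  rw [hr, Quiver.Path.nil_comp]

theorem HasNakayamaPermutation.targetDeterminesMaximalPath (hρ : ∀ p ∈ ρ, 2 ≤ p.len)
    [Module.Finite K (MonomialAlgebra K ρ)] (h : HasNakayamaPermutation (MonomialAlgebra K ρ)) :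
    TargetDeterminesMaximalPath ρ := by
  obtain ⟨σ, hσ⟩ := h
  have hcover (a : V) : ∃ π : projectiveAt K ρ a →ₗ[MonomialAlgebra K ρ]
      (simpleAt K hρ a).carrier, IsProjectiveCover π :=
    have := (simpleAt K hρ a).isSimple
    exists_isProjectiveCover hρ (isEigenvector_quotient K hρ a)
  have hmem {a b : V} {p : Quiver.Path a b} (hp : IsMaximalPath ρ p) : IsEigenvector K hρ b
      (⟨cls K ρ p, cls_mem_projectiveAt p⟩ : projectiveAt K ρ a) :=
    ⟨fun h0 => (hp.isEigenvector K hρ).1 (congrArg Subtype.val h0),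
      fun r => Subtype.ext ((hp.isEigenvector K hρ).2 r)⟩
  have hsoc {a b : V} {p : Quiver.Path a b} (hp : IsMaximalPath ρ p) :
      IsEigenvector K hρ b (⟨_, (hmem hp).mem_socle⟩ :
        socle (MonomialAlgebra K ρ) (projectiveAt K ρ a)) :=
    ⟨fun h0 => (hmem hp).1 (congrArg Subtype.val h0), fun r => Subtype.ext ((hmem hp).2 r)⟩
  have key {a b : V} {p : Quiver.Path a b} (hp : IsMaximalPath ρ p) :
      σ (simpleAt K hρ a).isoClass = (simpleAt K hρ b).isoClass := by
    obtain ⟨π, hπ⟩ := hcover a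
    obtain ⟨hs, hs'⟩ := (hσ (simpleAt K hρ a)).2 _ π hπ
    rw [hs']
    exact IsEigenvector.isoClass_eq (S := SimpleMod.mk _ hs) (hsoc hp)
  intro a a' b p q hp hq
  -- Injectivity of `σ` gives equal sources. Then `q` lies in the simple socle generated by `p`, so
  -- it is a scalar multiple of `p`.
  obtain rfl : a = a' :=
    (bijective_isoClass_simpleAt hρ).1 (σ.injective ((key hp).trans (key hq).symm))
  obtain ⟨π, hπ⟩ := hcover a
  obtain ⟨hs, -⟩ := (hσ (simpleAt K hρ a)).2 _ π hπ
  obtain ⟨r, hr⟩ := (hsoc hp).exists_smul_eq ⟨_, (hmem hq).mem_socle⟩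
  replace hr : r * cls K ρ p = cls K ρ q := congrArg (fun x => x.1.1) hr
  rw [← smul_eq_mul, (hp.isEigenvector K hρ).2, smul_eq_mul, ← Algebra.smul_def] at hr
  by_contra hne
  have h1 := congrArg (coeff K ρ q) hr
  rw [map_smul, coeff_cls_of_ne hne, coeff_cls_self hq.1, smul_zero] at h1
  exact zero_ne_one h1

variable (K) in
theorem TargetDeterminesMaximalPath.hasNakayamaPermutation (hρ : ∀ p ∈ ρ, 2 ≤ p.len)
    [Module.Finite K (MonomialAlgebra K ρ)] (h : TargetDeterminesMaximalPath ρ) :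
    HasNakayamaPermutation (MonomialAlgebra K ρ) := by
  obtain ⟨N, hN⟩ := exists_length_lt K ρ
  obtain ⟨T, P, hT, hP, hmax⟩ := h.exists_maximal hρ hN
  have hmem (a : V) : IsEigenvector K hρ (T a)
      (⟨cls K ρ (P a), cls_mem_projectiveAt (P a)⟩ : projectiveAt K ρ a) :=
    ⟨fun h0 => ((hP a).isEigenvector K hρ).1 (congrArg Subtype.val h0),
      fun r => Subtype.ext (((hP a).isEigenvector K hρ).2 r)⟩
  have hsoc (a : V) : IsEigenvector K hρ (T a) (⟨_, (hmem a).mem_socle⟩ :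
      socle (MonomialAlgebra K ρ) (projectiveAt K ρ a)) :=
    ⟨fun h0 => (hmem a).1 (congrArg Subtype.val h0), fun r => Subtype.ext ((hmem a).2 r)⟩
  have hsimple (a : V) : IsSimpleModule (MonomialAlgebra K ρ)
      (socle (MonomialAlgebra K ρ) (projectiveAt K ρ a)) := by
    refine (hsoc a).isSimpleModule fun ⟨⟨x, hxa⟩, hx⟩ => ?_
    refine ⟨algebraMap K _ (coeff K ρ (P a) x), Subtype.ext (Subtype.ext ?_)⟩
    change algebraMap K _ (coeff K ρ (P a) x) * cls K ρ (P a) = x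
    rw [← Algebra.smul_def]
    have hxF (j) (hj : j ∈ lengthFiltration K ρ 1) : j * x = 0 :=
      congrArg Subtype.val (smul_eq_zero_of_mem_socle hj hx)
    refine coeff_ext fun c d q hq => ?_
    by_cases heq : (⟨a, T a, P a⟩ : AnyPath V) = ⟨c, d, q⟩
    · cases heq
      rw [map_smul, coeff_cls_self hq, smul_eq_mul, mul_one]
    · rw [map_smul, coeff_cls_of_ne heq, smul_zero]
      by_cases hac : c = a
      · subst hac
        -- A good path `q` from the same vertex other than its maximal path has a good prolongation
        -- by some `α`. Its coefficient in `x` is that of `q.cons α` in `α x`, and `α x = 0` in the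
        -- socle.
        have hqm : ¬ IsMaximalPath ρ q := fun hqm => heq (by
          have := hmax _ _ q hqm
          rw [Sigma.mk.injEq] at this
          obtain ⟨rfl, h2⟩ := this
          rw [eq_of_heq h2])
        obtain ⟨e, α, hα⟩ : ∃ (e : V) (α : d ⟶ e), ¬ Bad ρ (q.cons α) := by
          by_contra! h0
          exact hqm ⟨hq, h0⟩
        rw [← coeff_cons_mul hα, hxF _ (cls_mem_lengthFiltration le_rfl), map_zero]
      · rw [← mem_projectiveAt_iff.1 hxa, coeff_mul_nil hac]
  let τ : Equiv.Perm V := Equiv.ofBijective T (Finite.injective_iff_bijective.1 hT)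
  let ε : V ≃ SimpleClass (MonomialAlgebra K ρ) :=
    Equiv.ofBijective _ (bijective_isoClass_simpleAt hρ)
  refine ⟨(ε.symm.trans τ).trans ε, fun S => ?_⟩
  obtain ⟨a, x, hx⟩ := exists_isEigenvector K hρ S.carrier
  obtain ⟨π, hπ⟩ := exists_isProjectiveCover hρ hx
  refine ⟨⟨_, _, _, π, hπ⟩, fun P' _ _ π' hπ' => ?_⟩
  obtain ⟨e⟩ := hπ.nonempty_equiv hπ'
  have := hsimple a
  have hs := IsSimpleModule.congr (socleEquiv e).symm
  refine ⟨hs, ?_⟩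
  have h1 : S.isoClass = ε a := hx.isoClass_eq
  rw [h1, Equiv.trans_apply, Equiv.trans_apply, Equiv.symm_apply_apply]
  exact (IsEigenvector.isoClass_eq (S := SimpleMod.mk _ hs)
    ((hsoc a).map (socleEquiv e).toLinearMap (socleEquiv e).injective)).symm

end Conditions

/-! ### Self-injectivity from a non-degenerate form -/

/-- A finite dimensional algebra with a linear form whose kernel contains no non-zero left ideal
is self-injective. -/
theorem isSelfInjective_of_nondegenerate {K : Type w} {A : Type u} [Field K] [Ring A] [Algebra K A]
    [Module.Finite K A] (φ : A →ₗ[K] K) (hφ : ∀ x : A, (∀ r, φ (r * x) = 0) → x = 0) :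
    IsSelfInjective A := by
  apply Module.Baer.injective
  intro I f
  let B : A →ₗ[K] Module.Dual K A := (LinearMap.mul K A).flip.compr₂ φ
  have hB (b r : A) : B b r = φ (r * b) := rfl
  have hinj : Function.Injective B := by
    rw [← LinearMap.ker_eq_bot, LinearMap.ker_eq_bot']
    intro b hb
    exact hφ b fun r => LinearMap.congr_fun hb r
  have hsurj : Function.Surjective B :=
    (LinearMap.injective_iff_surjective_of_finrank_eq_finrank
      (Subspace.dual_finrank_eq (K := K) (V := A)).symm).1 hinj
  -- The form `φ ∘ f` on `I` extends to `A` and is therefore `r ↦ φ (r * b)` for some `b`.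
  -- Non-degeneracy then upgrades equality under `φ` to `f x = x * b`.
  obtain ⟨g, hg⟩ := LinearMap.exists_extend (p := I.restrictScalars K)
    (φ ∘ₗ f.restrictScalars K : I →ₗ[K] K)
  obtain ⟨b, hb⟩ := hsurj g
  refine ⟨LinearMap.toSpanSingleton A A b, fun x hx => ?_⟩
  rw [LinearMap.toSpanSingleton_apply, smul_eq_mul, ← sub_eq_zero]
  refine hφ _ fun r => ?_
  have h1 : g (r * x) = φ (f ⟨r * x, I.mul_mem_left r hx⟩) :=
    LinearMap.congr_fun hg ⟨r * x, I.mul_mem_left r hx⟩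
  have h2 : f ⟨r * x, I.mul_mem_left r hx⟩ = r * f ⟨x, hx⟩ := f.map_smul r ⟨x, hx⟩
  rw [mul_sub, map_sub, ← mul_assoc, ← hB, hb, h1, h2, sub_self]

theorem IsSelfInjective.isSocleInjective {R : Type u} [Ring R] (h : IsSelfInjective R) :
    IsSocleInjective R :=
  fun f => h.out (Submodule.subtype _) (Submodule.subtype_injective _) f

theorem isSelfInjective_of_algEquiv {K : Type w} {A : Type u} [Field K] [Ring A] [Algebra K A]
    (e : A ≃ₐ[K] K) : IsSelfInjective A := by
  have : Module.Finite K A := Module.Finite.equiv e.symm.toLinearEquiv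
  refine isSelfInjective_of_nondegenerate e.toLinearMap fun x hx => ?_
  have := hx 1
  rwa [one_mul, AlgEquiv.toLinearMap_apply, map_eq_zero_iff e e.injective] at this

theorem isSelfInjective_of_unique_arrows {K : Type w} {V : Type u} [Field K] [Quiver.{v} V]
    [Fintype V] {ρ : Set (AnyPath V)} [Module.Finite K (MonomialAlgebra K ρ)] {l : ℕ}
    (hbad : ∀ (a b : V) (p : Quiver.Path a b), Bad ρ p ↔ l ≤ p.length)
    (hout : ∀ a : V, ∃ b : V, Nonempty (a ⟶ b))
    (hin : ∀ (a a' b : V) (α : a ⟶ b) (β : a' ⟶ b),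
      (⟨a, α⟩ : Σ a, (a ⟶ b)) = ⟨a', β⟩) :
    IsSelfInjective (MonomialAlgebra K ρ) := by
  have hpath (a : V) (m : ℕ) : ∃ (b : V) (p : Quiver.Path a b), p.length = m := by
    induction m with
    | zero => exact ⟨a, .nil, rfl⟩
    | succ m ih =>
      obtain ⟨b, p, hp⟩ := ih
      obtain ⟨c, ⟨α⟩⟩ := hout b
      exact ⟨c, p.cons α, by rw [Quiver.Path.length_cons, hp]⟩
  have huniq {a a' b : V} (p : Quiver.Path a b) (q : Quiver.Path a' b)
      (h : p.length = q.length) : (⟨a, b, p⟩ : AnyPath V) = ⟨a', b, q⟩ := by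
    induction p with
    | nil =>
      obtain rfl := q.eq_of_length_zero h.symm
      obtain rfl := q.eq_nil_of_length_zero h.symm
      rfl
    | @cons c d p α ih =>
      cases q with
      | nil => simp at h
      | @cons e _ q β =>
        have h1 := hin _ _ _ α β
        obtain rfl : c = e := congrArg Sigma.fst h1
        obtain rfl : α = β := by simpa using h1
        have h2 := ih q (by simpa using h)
        obtain rfl : a = a' := congrArg Sigma.fst h2
        obtain rfl : p = q := by simpa using h2
        rfl
  -- The form sums the coefficients of paths of length `l - 1`. Writing `p.len + 1 = l` makes it
  -- zero for `l = 0`, when every path is bad.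
  let φ : MonomialAlgebra K ρ →ₗ[K] K :=
    liftPaths (fun p => if p.len + 1 = l then 1 else 0) fun p hp => by
      rw [if_neg]
      have : l ≤ p.len := (hbad _ _ _).1 hp
      omega
  refine isSelfInjective_of_nondegenerate φ fun x hx => ?_
  refine eq_zero_of_coeff fun a b p hp => ?_
  have hpl : p.length < l := by
    by_contra h
    exact hp ((hbad _ _ _).2 (not_lt.1 h))
  -- Prolonging by `q` brings `p` to length exactly `l - 1`. As `p` is the only path of its length
  -- ending at `b`, `φ (q * y)` isolates its coefficient.
  obtain ⟨c, q, hq⟩ := hpath b (l - 1 - p.length)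
  have key (y : MonomialAlgebra K ρ) : φ (cls K ρ q * y) = coeff K ρ p y := by
    induction y using cls_induction with
    | zero => simp
    | add y z hy hz => rw [mul_add, map_add, map_add, hy, hz]
    | smul k y hy => rw [mul_smul_comm, map_smul, map_smul, hy]
    | path d e r hr =>
      by_cases he : e = b
      · subst he
        rw [cls_mul_cls, liftPaths_cls]
        simp only [AnyPath.len, Quiver.Path.length_comp]
        split_ifs with h
        · have h2 := huniq r p (by omega)
          obtain rfl : d = a := congrArg Sigma.fst h2
          obtain rfl : r = p := by simpa using h2
          rw [coeff_cls_self hp]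
        · rw [coeff_cls_of_ne]
          intro h2
          have := congrArg AnyPath.len h2
          simp only [AnyPath.len] at this
          omega
      · rw [cls_mul_cls_of_ne _ _ he, map_zero, coeff_cls_of_ne]
        intro h2
        cases h2
        exact he rfl
  rw [← key, hx]

theorem isSelfInjective_of_quiverIso {K : Type w} {V : Type u} [Field K] [Quiver.{v} V]
    [Fintype V] {ρ : Set (AnyPath V)} [Module.Finite K (MonomialAlgebra K ρ)] {n l : ℕ}
    (e : QuiverIso V (CyclicQuiver n)) (h : relIdeal K ρ = arrowIdeal K V ^ l) :
    IsSelfInjective (MonomialAlgebra K ρ) := by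
  let f : V ≃ ZMod n := e.vertexEquiv
  have hf {a b : V} (α : a ⟶ b) : f b = f a + 1 := (e.arrowEquiv a b α).2
  have hsub (a b : V) : Subsingleton (a ⟶ b) :=
    (e.arrowEquiv a b).injective.subsingleton (β := {_x : Unit // f b = f a + 1})
  refine isSelfInjective_of_unique_arrows (relIdeal_eq_arrowIdeal_pow_iff.1 h) (fun a => ?_)
    fun a a' b α β => ?_
  · refine ⟨f.symm (f a + 1), ⟨(e.arrowEquiv _ _).symm ⟨(), ?_⟩⟩⟩
    exact f.apply_symm_apply (f a + 1)
  · obtain rfl : a = a' := f.injective (add_right_cancel ((hf α).symm.trans (hf β)))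
    rw [Subsingleton.elim α β]

/-! ### The shape of the quiver -/

theorem connected_induction {V : Type u} [Quiver.{v} V]
    (hconn : Subsingleton (Quiver.WeaklyConnectedComponent V)) {P : V → Prop}
    (hP : ∀ (a b : V) (_ : a ⟶ b), P a ↔ P b) {a : V} (ha : P a) (b : V) : P b := by
  obtain ⟨p⟩ : Nonempty (@Quiver.Path (Quiver.Symmetrify V) _ a b) := Quotient.exact
    (hconn.elim (Quotient.mk (Quiver.zigzagSetoid V) a) (Quotient.mk _ b))
  induction p with
  | nil => exact ha
  | cons p α ih =>
    obtain α | α := α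
    · exact (hP _ _ α).1 ih
    · exact (hP _ _ α).2 ih

/-- Stripping the last arrows of `q` and `q'` together leaves `p` and `p'`. The Sigma type is needed
because `b = c` is part of the conclusion. -/
theorem sigma_eq_of_comp_eq_comp {V : Type u} [Quiver.{v} V] {a b c d : V} {p : Quiver.Path a b}
    {q : Quiver.Path b d} {p' : Quiver.Path a c} {q' : Quiver.Path c d}
    (h : p.comp q = p'.comp q') (hl : p.length = p'.length) :
    (⟨b, p⟩ : Σ b, Quiver.Path a b) = ⟨c, p'⟩ := by
  have hl' := congrArg Quiver.Path.length h
  simp only [Quiver.Path.length_comp] at hl'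
  induction q with
  | nil =>
    obtain rfl := q'.eq_of_length_zero (by simp at hl'; omega)
    obtain rfl := q'.eq_nil_of_length_zero (by simp at hl'; omega)
    rw [Quiver.Path.comp_nil, Quiver.Path.comp_nil] at h
    rw [h]
  | @cons e f q α ih =>
    cases q' with
    | nil => simp at hl'; omega
    | @cons g _ q' β =>
      rw [Quiver.Path.comp_cons, Quiver.Path.comp_cons] at h
      obtain rfl := Quiver.Path.obj_eq_of_cons_eq_cons h
      exact ih (eq_of_heq (Quiver.Path.heq_of_cons_eq_cons h)) (by simp at hl'; omega)

/-- A quiver on which a bijection `s` of the vertices prescribes the arrows is cyclic. -/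
theorem exists_quiverIso_cyclicQuiver {V : Type u} [Quiver.{v} V] [Finite V] [Nonempty V]
    (hconn : Subsingleton (Quiver.WeaklyConnectedComponent V)) (s : Equiv.Perm V)
    (α : ∀ a, a ⟶ s a)
    (hα : ∀ (a b : V) (β : a ⟶ b), (⟨b, β⟩ : Σ b, (a ⟶ b)) = ⟨s a, α a⟩) :
    ∃ n : ℕ, 1 ≤ n ∧ Nonempty (QuiverIso V (CyclicQuiver n)) := by
  obtain ⟨a₀⟩ := ‹Nonempty V›
  have hs {a b : V} (β : a ⟶ b) : b = s a := congrArg Sigma.fst (hα a b β)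
  have hsub (a b : V) : Subsingleton (a ⟶ b) := by
    refine ⟨fun β γ => ?_⟩
    have h := (hα a b β).trans (hα a b γ).symm
    simpa using h
  have horb (b : V) : ∃ k : ℤ, (s ^ k) a₀ = b := by
    refine connected_induction hconn (P := fun b => ∃ k : ℤ, (s ^ k) a₀ = b) (fun a b β => ?_)
      ⟨0, rfl⟩ b
    obtain rfl := hs β
    constructor
    · rintro ⟨k, rfl⟩
      exact ⟨1 + k, by rw [zpow_add, zpow_one, Equiv.Perm.mul_apply]⟩
    · rintro ⟨k, hk⟩
      exact ⟨-1 + k, by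
             rw [zpow_add, Equiv.Perm.mul_apply, hk, zpow_neg_one]
             exact s.symm_apply_apply a⟩
  -- By connectedness the orbit of `a₀` under `s` is all of `V`, so its period counts the vertices.
  let n := Function.minimalPeriod (fun x => s • x) a₀
  let g : ZMod n → V := fun k => ((MulAction.orbitZPowersEquiv s a₀).symm k).1
  have hg (k : ℤ) : g k = (s ^ k) a₀ := by
    simp only [g]
    rw [MulAction.orbitZPowersEquiv_symm_apply']
    rfl
  have hgbij : Function.Bijective g := by
    refine ⟨Subtype.val_injective.comp (Equiv.injective _), fun b => ?_⟩
    obtain ⟨k, rfl⟩ := horb b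
    exact ⟨k, hg k⟩
  let f : V ≃ ZMod n := (Equiv.ofBijective g hgbij).symm
  have hf (a : V) : f (s a) = f a + 1 := by
    rw [Equiv.symm_apply_eq]
    obtain ⟨k, hk⟩ := ZMod.intCast_surjective (f a)
    have h1 : g (f a) = a := Equiv.apply_symm_apply (Equiv.ofBijective g hgbij) a
    have h2 : (f a + 1 : ZMod n) = ((1 + k : ℤ) : ZMod n) := by
      rw [← hk]; push_cast; exact add_comm _ _
    change s a = g (f a + 1)
    rw [h2, hg, zpow_add, zpow_one, Equiv.Perm.mul_apply, ← hg, hk, h1]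
  refine ⟨n, ?_, ⟨{ vertexEquiv := f, arrowEquiv := fun a b => ?_ }⟩⟩
  -- Period zero would make `V` equivalent to `ZMod 0 = ℤ`, which is infinite.
  · by_contra hn
    have hn0 : n = 0 := by omega
    have : Finite (ZMod n) := Finite.of_equiv V f
    rw [hn0] at this
    exact (inferInstance : Infinite ℤ).not_finite this
  · change (a ⟶ b) ≃ {_x : Unit // f b = f a + 1}
    refine equivOfSubsingletonOfSubsingleton (fun β => ⟨(), by rw [hs β, hf]⟩) (fun β => ?_)
    have h2 := β.2
    rw [← hf] at h2
    exact f.injective h2 ▸ α a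

theorem nonempty_algEquiv_of_isEmpty {K : Type w} {V : Type u} [Field K] [Quiver.{v} V]
    [Fintype V] {ρ : Set (AnyPath V)} (hρ : ∀ p ∈ ρ, 2 ≤ p.len) (a : V) (ha : ∀ b, b = a)
    (hempty : ∀ b c : V, IsEmpty (b ⟶ c)) : Nonempty (MonomialAlgebra K ρ ≃ₐ[K] K) := by
  refine ⟨AlgEquiv.ofBijective (character K hρ a) ⟨?_, fun c => ⟨algebraMap K _ c, ?_⟩⟩⟩
  · rw [injective_iff_map_eq_zero]
    intro x hx
    refine eq_zero_of_coeff fun b c p _ => ?_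
    cases p with
    | nil =>
      obtain rfl := ha b
      exact hx
    | cons p α => exact (hempty _ _).elim α
  · rw [AlgHom.commutes]; rfl

theorem TargetDeterminesMaximalPath.algEquiv_or_cyclic {K : Type w} {V : Type u} [Field K]
    [Quiver.{v} V] [Fintype V] [Nonempty V] {ρ : Set (AnyPath V)}
    [Module.Finite K (MonomialAlgebra K ρ)] (hρ : ∀ p ∈ ρ, 2 ≤ p.len)
    (hconn : Subsingleton (Quiver.WeaklyConnectedComponent V))
    (h : TargetDeterminesMaximalPath ρ) :
    Nonempty (MonomialAlgebra K ρ ≃ₐ[K] K) ∨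
      ∃ n l : ℕ, 1 ≤ n ∧ 1 < l ∧ Nonempty (QuiverIso V (CyclicQuiver n)) ∧
        relIdeal K ρ = arrowIdeal K V ^ l := by
  obtain ⟨N, hN⟩ := exists_length_lt K ρ
  have hgood {a b : V} {p : Quiver.Path a b} (hp : p.length < 2) : ¬ Bad ρ p :=
    not_bad_of_length_lt hρ hp
  by_cases hsink : ∃ a : V, ∀ b : V, IsEmpty (a ⟶ b)
  · left
    obtain ⟨a, ha⟩ := hsink
    -- At a sink both the stationary path and any incoming arrow are maximal, with the same target
    -- but different lengths.
    have hto (c : V) (α : c ⟶ a) : False := by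
      have h1 := h a c a .nil α.toPath ⟨hgood (by simp), fun c β => (ha c).elim β⟩
        ⟨hgood (by simp), fun c β => (ha c).elim β⟩
      exact zero_ne_one (congrArg AnyPath.len h1)
    have hall (b : V) : b = a := by
      refine connected_induction hconn (P := fun b => b = a) (fun c d α => ?_) rfl b
      constructor
      · rintro rfl
        exact (ha d).elim α
      · rintro rfl
        exact (hto c α).elim
    refine nonempty_algEquiv_of_isEmpty hρ a hall fun b c => ?_
    rw [hall b]
    exact ha c
  right
  obtain ⟨T, P, hT, hP, hmax⟩ := h.exists_maximal hρ hN
  push Not at hsink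
  choose s hs' using hsink
  have α (a : V) : a ⟶ s a := (hs' a).some
  -- A good path prolongs to a maximal one, and `P a` is the only maximal path from `a`.
  have hpre {a b : V} (p : Quiver.Path a b) (hp : ¬ Bad ρ p) :
      ∃ q : Quiver.Path b (T a), P a = p.comp q := by
    obtain ⟨c, q, hq⟩ := exists_isMaximalPath_comp hN p hp
    have h1 := hmax _ _ _ hq
    obtain rfl : c = T a := congrArg Sigma.fst h1
    exact ⟨q, by simpa using h1.symm⟩
  have hα (a b : V) (β : a ⟶ b) : (⟨b, β⟩ : Σ b, (a ⟶ b)) = ⟨s a, α a⟩ := by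
    obtain ⟨q, hq⟩ := hpre β.toPath (hgood (by simp))
    obtain ⟨q', hq'⟩ := hpre (α a).toPath (hgood (by simp))
    have h1 := sigma_eq_of_comp_eq_comp (hq.symm.trans hq') rfl
    cases h1
    rfl
  have hs {a b : V} (β : a ⟶ b) : b = s a := congrArg Sigma.fst (hα a b β)
  have huniq {a b c : V} (p : Quiver.Path a b) (q : Quiver.Path a c) (hl : p.length = q.length) :
      (⟨b, p⟩ : Σ b, Quiver.Path a b) = ⟨c, q⟩ := by
    induction p generalizing c with
    | nil =>
      obtain rfl := q.eq_of_length_zero hl.symm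
      obtain rfl := q.eq_nil_of_length_zero hl.symm
      rfl
    | @cons d e p β ih =>
      cases q with
      | nil => simp at hl
      | @cons d' _ q γ =>
        have h1 := ih q (by simpa using hl)
        cases h1
        have h2 := (hα _ _ β).trans (hα _ _ γ).symm
        cases h2
        rfl
  have htarget {a b : V} (p : Quiver.Path a b) : b = s^[p.length] a := by
    induction p with
    | nil => rfl
    | cons p β ih => rw [Quiver.Path.length_cons, Function.iterate_succ_apply', ← ih, hs β]
  let ℓ : V → ℕ := fun a => (P a).length
  have hle {a b : V} {p : Quiver.Path a b} (hp : ¬ Bad ρ p) : p.length ≤ ℓ a := by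
    obtain ⟨q, hq⟩ := hpre p hp
    simp only [ℓ]
    rw [hq, Quiver.Path.length_comp]
    omega
  have hbad {a b : V} (p : Quiver.Path a b) : Bad ρ p ↔ ℓ a + 1 ≤ p.length := by
    constructor
    · intro hp
      by_contra hlt
      -- A bad `p` no longer than `P a` would be its initial segment of that length and make `P a`
      -- bad.
      obtain ⟨c, p₁, p₂, hc, hl⟩ := (P a).exists_eq_comp_of_le_length
        (n := p.length) (by simp only [ℓ] at hlt; omega)
      have h1 := huniq p p₁ hl.symm
      cases h1
      exact (hP a).1 (hc ▸ hp.comp_right p₂)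
    · intro hl
      by_contra hp
      have := hle hp
      omega
  have hpos (a : V) : 1 ≤ ℓ a := hle (p := (α a).toPath) (hgood (by simp))
  -- Removing the first arrow of `P a` leaves a good path from `s a`, so only `ℓ a = ℓ (s a) + 1`
  -- must be excluded. In that case `T (s a) = T a`, so `s a = a`, which is absurd.
  have hmono (a : V) : ℓ a ≤ ℓ (s a) := by
    obtain ⟨c, β, q, hq, hl⟩ := (Quiver.Path.length_ne_zero_iff_eq_comp (P a)).1
      (Nat.one_le_iff_ne_zero.1 (hpos a))
    have hql : q.length ≤ ℓ c := hle fun hb => (hP a).1 (hq ▸ hb.comp_left _)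
    obtain rfl := hs β
    by_contra hlt
    have hℓ : ℓ a = ℓ (s a) + 1 := by simp only [ℓ] at *; omega
    have h1 : T (s a) = T a := by
      rw [htarget (P (s a)), htarget (P a)]
      change s^[ℓ (s a)] (s a) = s^[ℓ a] a
      rw [hℓ, Function.iterate_succ_apply]
    rw [hT h1] at hℓ
    omega
  have hsurj : Function.Surjective s := by
    intro b
    obtain ⟨a, rfl⟩ := (Finite.injective_iff_surjective.1 hT) b
    obtain ⟨m, hm⟩ := Nat.exists_eq_add_of_le' (hpos a)
    refine ⟨s^[m] a, ?_⟩
    rw [← Function.iterate_succ_apply' s, Nat.succ_eq_add_one, ← hm]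
    exact (htarget (P a)).symm
  let σ : Equiv.Perm V := Equiv.ofBijective s (Finite.surjective_iff_bijective.1 hsurj)
  -- As `σ` permutes `V`, both sides of the inequalities `hmono` have the same sum, so each is an
  -- equality.
  have hconst (a : V) : ℓ a = ℓ (s a) :=
    (Finset.sum_eq_sum_iff_of_le fun a _ => hmono a).1 (Equiv.sum_comp σ ℓ).symm a
      (Finset.mem_univ a)
  obtain ⟨a₀⟩ := ‹Nonempty V›
  have hall (b : V) : ℓ b = ℓ a₀ := by
    refine connected_induction hconn (P := fun b => ℓ b = ℓ a₀) (fun c d β => ?_) rfl b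
    obtain rfl := hs β
    rw [hconst c]
  have : Nonempty V := ⟨a₀⟩
  obtain ⟨n, hn, hiso⟩ := exists_quiverIso_cyclicQuiver hconn σ α hα
  have := hpos a₀
  refine ⟨n, ℓ a₀ + 1, hn, by omega, hiso, relIdeal_eq_arrowIdeal_pow_iff.2 fun a b p => ?_⟩
  rw [hbad, hall]

end MonomialQuiver

end

/-! ### The equivalence of the four conditions -/

theorem theorem1p1 {K : Type*} [Field K] [IsAlgClosed K]
    {V : Type*} [Quiver V] [Fintype V] [∀ a b : V, Finite (a ⟶ b)]
    [Nonempty V] (hconn : Subsingleton (Quiver.WeaklyConnectedComponent V))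
    (ρ : Set (MonomialQuiver.AnyPath V)) (hρ : ∀ p ∈ ρ, 2 ≤ p.len)
    (hfin : Module.Finite K (MonomialQuiver.MonomialAlgebra K ρ)) :
    List.TFAE [
      MonomialQuiver.IsSelfInjective (MonomialQuiver.MonomialAlgebra K ρ),
      MonomialQuiver.HasNakayamaPermutation (MonomialQuiver.MonomialAlgebra K ρ),
      MonomialQuiver.IsSocleInjective (MonomialQuiver.MonomialAlgebra K ρ),
      Nonempty (MonomialQuiver.MonomialAlgebra K ρ ≃ₐ[K] K) ∨
        ∃ n l : ℕ, 1 ≤ n ∧ 1 < l ∧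
          Nonempty (MonomialQuiver.QuiverIso V (MonomialQuiver.CyclicQuiver n)) ∧
          MonomialQuiver.relIdeal K ρ = MonomialQuiver.arrowIdeal K V ^ l] := by
  tfae_have 1 → 3 := fun h => h.isSocleInjective
  tfae_have 3 → 2 := fun h =>
    (h.targetDeterminesMaximalPath hρ).hasNakayamaPermutation K hρ
  tfae_have 2 → 4 := fun h => (h.targetDeterminesMaximalPath hρ).algEquiv_or_cyclic hρ hconn
  tfae_have 4 → 1 := by
    rintro (⟨⟨e⟩⟩ | ⟨n, l, -, -, ⟨e⟩, h⟩)
    · exact MonomialQuiver.isSelfInjective_of_algEquiv e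
    · exact MonomialQuiver.isSelfInjective_of_quiverIso e h
  tfae_finish
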